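/- Let $n\ge 1$, let $U\subset\mathbb R$ be an open interval, and let $\varphi=(\varphi_1,\dots,\varphi_n):U\to\mathbb R^n$ be an analytic map which is nondegenerate, i.e. $1,\varphi_1,\dots,\varphi_n$ are linearly independent over $\mathbb R$ as functions on $U$. Let $C>1$, $\alpha>0$, $\rho_0>0$, and let $\mu$ be a Borel measure on $\mathbb R$ that is $(C,\alpha)$-Ahlfors regular at scales up to $\rho_0$: $C^{-1}r^\alpha\le\mu(B(x,r))\le Cr^\alpha$ for all $x\in\operatorname{supp}\mu$ and $0<r\le\rho_0$, where $B(x,r)$ is the closed ball. Let $x_0\in\operatorname{supp}\mu\cap U$. For a bounded interval $J$, $\lambda J$ denotes the interval of length $\lambda|J|$ with the same midpoint. For $\mathbf x\in\mathbb R^n$ (a row) let $u(\mathbf x)=\begin{pmatrix}1&\mathbf x\\0&\mathrm I_n\end{pmatrix}$, and let $z(x)=\begin{pmatrix}1&0&0\\0&1&\psi(x)\\0&0&\mathrm I_{n-1}\end{pmatrix}$ with $\psi(x)=(\varphi_2'(x),\dots,\varphi_n'(x))$. For $\tau=(\tau_1,\dots,\tau_{n+1})\in\mathbb R^{n+1}$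 with $\tau_1+\dots+\tau_{n+1}=0$ let $g_\tau=\operatorname{diag}(e^{\tau_1},\dots,e^{\tau_{n+1}})$. For $\delta>0$ let $K_\delta$ be the set of unimodular lattices in $\mathbb R^{n+1}$ all of whose nonzero vectors have Euclidean norm at least $\delta$, and put $$W(\tau,J,\delta)=\{x\in J: g_\tau z(x)u(\varphi(x))\mathbb Z^{n+1}\notin K_\delta\}.$$ A matrix $L$ acts on multivectors by $L(\mathbf v_1\wedge\dots\wedge\mathbf v_i)=L\mathbf v_1\wedge\dots\wedge L\mathbf v_i$, and $\|\cdot\|$ is the Euclidean norm on $\bigwedge^i(\mathbb R^{n+1})$ for which the standard basis $\mathbf e_{j_1}\wedge\dots\wedge\mathbf e_{j_i}$, $j_1<\dots<j_i$, is orthonormal. **Theorem (Local Estimate).** There is $\eta>0$ such that for every closed interval $I_0$ centred at $x_0$ with $0<|I_0|\le\eta$, $3|I_0|\le\rho_0$, $3^{n+1}I_0\subset U$ and $\varphi_1(x)=x$ for all $x\in 3^{n+1}I_0$, there exist constants $M_1>0$ and $\gamma>0$ such that for every $\delta>0$, every $\tau\in\mathbb R^{n+1}$ with $\tau_1+\dots+\tau_{n+1}=0$,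 every $0\le\rho\le1$ and every subinterval $J\subset I_0$ at least one of the following holds: 1. $\mu(W(\tau,J,\delta))\le M_1\left(\dfrac{\delta}{\rho}\right)^{\gamma}\mu(3J)$, where for $\rho=0$ we read $\delta/\rho=\infty$ and $\infty\cdot 0=0$; 2. there exist $1\le i\le n$ and $\mathbf v_1,\dots,\mathbf v_i\in\mathbb Z^{n+1}$ such that $\mathbf v=\mathbf v_1\wedge\dots\wedge\mathbf v_i\ne\mathbf 0$ and $$\sup_{x\in J}\|g_\tau z(x)u(\varphi(x))\mathbf v\|<\rho,$$ the supremum being over all $x\in J$, not only over $x\in J\cap\operatorname{supp}\mu$. -/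

import Mathlib

open MeasureTheory
open scoped ENNReal MatrixGroups

noncomputable section

namespace QND

/-- `ℝ^k` with the Euclidean norm. -/
abbrev E (k : ℕ) : Type := EuclideanSpace ℝ (Fin k)

/-! ### Measures, intervals and maps -/

/-- `μ` is `(C, α)`-Ahlfors regular, the scale up to which the bounds hold being `ρ₀`. -/
structure IsAhlforsRegular (C α ρ₀ : ℝ) (μ : Measure ℝ) : Prop where
  one_lt_C : 1 < C
  alpha_pos : 0 < α
  scale_pos : 0 < ρ₀
  lower : ∀ x ∈ μ.support, ∀ ρ : ℝ, 0 < ρ → ρ ≤ ρ₀ →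
    ENNReal.ofReal (C⁻¹ * ρ ^ α) ≤ μ (Metric.closedBall x ρ)
  upper : ∀ x ∈ μ.support, ∀ ρ : ℝ, 0 < ρ → ρ ≤ ρ₀ →
    μ (Metric.closedBall x ρ) ≤ ENNReal.ofReal (C * ρ ^ α)

/-- The midpoint of a bounded interval. -/
def center (J : Set ℝ) : ℝ := (sInf J + sSup J) / 2

/-- `lam J`: the bounded interval `J` scaled by the factor `lam` about its own midpoint. -/
def dilate (lam : ℝ) (J : Set ℝ) : Set ℝ :=
  (fun x => center J + lam * (x - center J)) '' J

/-- The closed interval of length `ℓ` centred at `x₀`. -/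
def centredInterval (x₀ ℓ : ℝ) : Set ℝ := Set.Icc (x₀ - ℓ / 2) (x₀ + ℓ / 2)

/-- `φ = (φ₁, …, φₙ)` is nondegenerate on `U`: the functions `1, φ₁, …, φₙ` are linearly
independent over `ℝ` as functions on `U`. -/
def Nondegenerate {n : ℕ} (U : Set ℝ) (φ : ℝ → Fin n → ℝ) : Prop :=
  LinearIndependent ℝ
    (Fin.cons (fun _ => 1) (fun i x => φ x i) : Fin (n + 1) → (U → ℝ))

/-! ### Matrices -/

/-- The matrix with first row `(1, x)` and with the identity matrix below `x`. -/
def uMatrix {n : ℕ} (x : Fin n → ℝ) : Matrix (Fin (n + 1)) (Fin (n + 1)) ℝ :=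
  Matrix.of (Fin.cons (Fin.cons 1 x) (fun i => Pi.single i.succ 1))

lemma det_uMatrix {n : ℕ} (x : Fin n → ℝ) : (uMatrix x).det = 1 := by
  rw [Matrix.det_of_isUpperTriangular]
  · apply Finset.prod_eq_one
    intro i _
    refine Fin.cases ?_ (fun i => ?_) i <;> simp [uMatrix]
  · intro i j hij
    induction i using Fin.cases with
    | zero => simp at hij
    | succ i => simp only [id_eq] at hij; simp [uMatrix, hij.ne]

/-- `u(x) = [1, x; 0, I_n]`. -/
def u {n : ℕ} (x : Fin n → ℝ) : SL(n + 1, ℝ) := ⟨uMatrix x, det_uMatrix x⟩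

/-- The block diagonal matrix with blocks `1` and `u(y)`. -/
def u₁Matrix {m : ℕ} (y : Fin m → ℝ) : Matrix (Fin (m + 2)) (Fin (m + 2)) ℝ :=
  Matrix.of (Fin.cons (Pi.single 0 1) (fun i => Fin.cons 0 (uMatrix y i)))

lemma det_u₁Matrix {m : ℕ} (y : Fin m → ℝ) : (u₁Matrix y).det = 1 := by
  rw [Matrix.det_of_isUpperTriangular]
  · apply Finset.prod_eq_one
    intro i _
    refine Fin.cases ?_ (fun i => ?_) i
    · simp [u₁Matrix]
    · refine Fin.cases ?_ (fun i => ?_) i <;> simp [u₁Matrix, uMatrix]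
  · intro i j hij
    simp only [id_eq] at hij
    induction i using Fin.cases with
    | zero => simp at hij
    | succ i =>
      induction j using Fin.cases with
      | zero => simp [u₁Matrix]
      | succ j =>
        induction i using Fin.cases with
        | zero => simp at hij
        | succ i =>
          have h : j ≠ i.succ := (Fin.succ_lt_succ_iff.mp hij).ne
          simp [u₁Matrix, uMatrix, h]

/-- `u₁(y)`: the identity matrix with `y = (y₂, …, yₙ)` put in columns `3, …, n + 1` of the
second row; here `n = m + 1`. -/
def u₁ {m : ℕ} (y : Fin m → ℝ) : SL(m + 2, ℝ) := ⟨u₁Matrix y, det_u₁Matrix y⟩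

/-- `ψ(x) = (φ₂'(x), …, φₙ'(x))`. -/
def ψ {m : ℕ} (φ : ℝ → Fin (m + 1) → ℝ) (x : ℝ) : Fin m → ℝ :=
  fun j => deriv (fun t => φ t j.succ) x

/-- `z(x) = u₁(ψ(x))`. -/
def z {m : ℕ} (φ : ℝ → Fin (m + 1) → ℝ) (x : ℝ) : SL(m + 2, ℝ) := u₁ (ψ φ x)

/-- `g_τ = diag(e^{τ₁}, …, e^{τ_k})`, where `τ₁ + ⋯ + τ_k = 0`. -/
def g {k : ℕ} (τ : Fin k → ℝ) (hτ : ∑ i, τ i = 0) : SL(k, ℝ) :=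
  ⟨Matrix.diagonal fun i => Real.exp (τ i), by
    rw [Matrix.det_diagonal, ← Real.exp_sum, hτ, Real.exp_zero]⟩

/-! ### Lattices -/

/-- An integer vector as a vector of `ℝ^k`. -/
def intVec {k : ℕ} (p : Fin k → ℤ) : E k := WithLp.toLp 2 fun i => (p i : ℝ)

/-- The lattice `h ℤ^k`. -/
def lat {k : ℕ} (h : SL(k, ℝ)) : AddSubgroup (E k) where
  carrier := Set.range fun p : Fin k → ℤ => Matrix.toEuclideanLin h.1 (intVec p)
  zero_mem' := ⟨0, by
    have : intVec (0 : Fin k → ℤ) = 0 := by ext i; simp [intVec]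
    simp only [this, map_zero]⟩
  add_mem' := by
    rintro _ _ ⟨p, rfl⟩ ⟨q, rfl⟩
    refine ⟨p + q, ?_⟩
    have : intVec (p + q) = intVec p + intVec q := by ext i; simp [intVec]
    simp only [this, map_add]
  neg_mem' := by
    rintro _ ⟨p, rfl⟩
    refine ⟨-p, ?_⟩
    have : intVec (-p) = -intVec p := by ext i; simp [intVec]
    simp only [this, map_neg]

/-- The space `X_k` of unimodular lattices in `ℝ^k`. -/
def X (k : ℕ) : Set (AddSubgroup (E k)) := Set.range lat

/-- `K_ε`: the unimodular lattices all of whose nonzero vectors have Euclidean norm at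
least `ε`. -/
def K {k : ℕ} (ε : ℝ) : Set (AddSubgroup (E k)) :=
  {Λ | Λ ∈ X k ∧ ∀ v ∈ Λ, v ≠ 0 → ε ≤ ‖v‖}

/-- `g_τ z(x) u(φ(x))`. -/
def H {m : ℕ} (φ : ℝ → Fin (m + 1) → ℝ) (τ : Fin (m + 2) → ℝ) (hτ : ∑ i, τ i = 0) (x : ℝ) :
    SL(m + 2, ℝ) :=
  g τ hτ * z φ x * u (φ x)

/-- `W(τ, J, δ) = {x ∈ J : g_τ z(x) u(φ(x)) ℤ^{n+1} ∉ K_δ}`. -/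
def W {m : ℕ} (φ : ℝ → Fin (m + 1) → ℝ) (τ : Fin (m + 2) → ℝ) (hτ : ∑ i, τ i = 0)
    (J : Set ℝ) (δ : ℝ) : Set ℝ :=
  {x ∈ J | lat (H φ τ hτ x) ∉ K δ}

/-! ### Multivectors

The norm on `⋀[ℝ]^i (E k)` is Mathlib's: the Euclidean norm for which the vectors
`e_{j₁} ∧ ⋯ ∧ e_{j_i}`, `j₁ < ⋯ < j_i`, form an orthonormal basis. -/

/-- The integral multivector `p₁ ∧ ⋯ ∧ p_i`, for integer vectors `p₁, …, p_i`. -/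
def intWedge {k i : ℕ} (p : Fin i → Fin k → ℤ) : ⋀[ℝ]^i (E k) :=
  exteriorPower.ιMulti ℝ i fun j => intVec (p j)

/-- The action of a matrix `L` on multivectors, `L (v₁ ∧ ⋯ ∧ v_i) = L v₁ ∧ ⋯ ∧ L v_i`. -/
def wedgeAct {k i : ℕ} (L : SL(k, ℝ)) : ⋀[ℝ]^i (E k) →ₗ[ℝ] ⋀[ℝ]^i (E k) :=
  exteriorPower.map i (Matrix.toEuclideanLin L.1)

end QND

end

/-! This is the Kleinbock–Margulis nondivergence argument, run with an Ahlfors regular measure.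
Write `H x` for the matrix acting at `x`. To each rational subspace attach a covolume: the largest
minor, in absolute value, of `H x` applied to an optimal integer basis. If alternative 2 fails,
every nonzero proper rational subspace has covolume at least a fixed multiple of `ρ` somewhere on
the closure of `J`. It remains to see that short lattice vectors are then rare.

Analysis: the minors are linear combinations of finitely many analytic functions, the minors of
`z(x) u(φ(x))`; `τ` and the integer vectors enter only through the coefficients. Near `x₀` every
such combination has a dominant derivative of bounded order, so by interpolation it cannot be tiny
at many separated points of an interval unless it is small on all of it (`exists_good`). Hence its
sublevel sets lie in boundedly many short intervals and have small measure, uniformly in the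
coefficients (`measure_abs_le_le`, `exists_covol_good`).

Combinatorics: a point is marked if some flag of subspaces has covolumes in `[ε, ρ]` and all other
subspaces compatible with it have covolume at least `ρ`. Around an unmarked point take the largest
ball on which some subspace stays below `ρ`. On the closed ball every subspace reaches `ρ`, so
induction on the length of flags applies to the subspaces comparable with the chosen one.
Besicovitch's theorem adds up the balls (`exists_measure_not_marked_le`).

Arithmetic: at a marked point, adjoining an integer vector to a suitable member of the flag, or to
zero, multiplies covolume by at most a constant times the length of the vector. The result cannot
have covolume below `ε`, so the vector is not short (`le_norm_mulVec_of_marked`). -/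

/-! ### Divided differences and values at separated points. -/

/-- Each use of Rolle between consecutive points costs one point and gains one derivative. -/
theorem QND.exists_iteratedDeriv_eq_zero {l : ℕ} : ∀ {f : ℝ → ℝ} {s t : ℝ} {S : Finset ℝ},
    AnalyticOnNhd ℝ f (Set.Icc s t) → ↑S ⊆ Set.Icc s t → S.card = l + 1 → (∀ y ∈ S, f y = 0) →
    ∃ ξ ∈ Set.Icc s t, iteratedDeriv l f ξ = 0 := by
  induction l with
  | zero =>
    intro f s t S _ hS hc h0
    obtain ⟨y, hy⟩ : S.Nonempty := by rw [← Finset.card_pos]; omega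
    exact ⟨y, hS hy, by simpa using h0 y hy⟩
  | succ l ih =>
    intro f s t S hf hS hc h0
    let e := S.orderEmbOfFin hc
    have he : ∀ i, e i ∈ S := fun i => S.orderEmbOfFin_mem hc i
    have hR : ∀ i : Fin (l + 1), ∃ c ∈ Set.Ioo (e i.castSucc) (e i.succ), deriv f c = 0 := by
      intro i
      refine exists_deriv_eq_zero (e.strictMono i.castSucc_lt_succ) ?_ ?_
      · refine hf.continuousOn.mono (Set.Icc_subset_Icc (hS (he _)).1 (hS (he _)).2)
      · rw [h0 _ (he _), h0 _ (he _)]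
    choose c hc1 hc2 using hR
    have hmono : StrictMono c := by
      refine Fin.strictMono_iff_lt_succ.2 ?_
      intro i
      calc c i.castSucc < e i.castSucc.succ := (hc1 _).2
        _ = e i.succ.castSucc := by rw [Fin.succ_castSucc]
        _ < c i.succ := (hc1 _).1
    obtain ⟨ξ, hξ, h⟩ := ih (f := deriv f) (s := s) (t := t) (S := Finset.univ.image c)
      hf.deriv
      (by
        intro x hx
        simp only [Finset.coe_image, Finset.coe_univ, Set.image_univ, Set.mem_range] at hx
        obtain ⟨i, rfl⟩ := hx
        exact ⟨(hS (he _)).1.trans (hc1 i).1.le, (hc1 i).2.le.trans (hS (he _)).2⟩)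
      (by rw [Finset.card_image_of_injective _ hmono.injective]; simp)
      (by
        intro y hy
        simp only [Finset.mem_image, Finset.mem_univ, true_and] at hy
        obtain ⟨i, rfl⟩ := hy
        exact hc2 i)
    exact ⟨ξ, hξ, by rwa [iteratedDeriv_succ']⟩

theorem QND.iteratedDeriv_polynomial_eval (l : ℕ) (P : Polynomial ℝ) :
    iteratedDeriv l (fun x => P.eval x) = fun x => (Polynomial.derivative^[l] P).eval x := by
  induction l generalizing P with
  | zero => simp
  | succ l ih =>
    rw [iteratedDeriv_succ', Function.iterate_succ_apply, ← ih]
    congr 1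
    ext x
    exact P.deriv

/-- The mean value theorem for divided differences. -/
theorem QND.exists_dividedDifference_eq {l : ℕ} {f : ℝ → ℝ} {s t : ℝ} {S : Finset ℝ}
    (hf : AnalyticOnNhd ℝ f (Set.Icc s t)) (hS : ↑S ⊆ Set.Icc s t) (hc : S.card = l + 1) :
    ∃ ξ ∈ Set.Icc s t,
      ∑ y ∈ S, f y / ∏ z ∈ S.erase y, (y - z) = iteratedDeriv l f ξ / l.factorial := by
  let P := Lagrange.interpolate S id f
  have hinj : Set.InjOn (id : ℝ → ℝ) S := Function.injective_id.injOn
  have hdeg : P.degree < S.card := Lagrange.degree_interpolate_lt _ hinj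
  have hPan : AnalyticOnNhd ℝ (fun x => P.eval x) (Set.Icc s t) := fun x _ => by
    simpa using AnalyticAt.aeval_polynomial (analyticAt_id (𝕜 := ℝ) (z := x)) P
  -- The `l`-th derivative of the interpolating polynomial is constant, namely `l!` times the
  -- divided difference.
  obtain ⟨ξ, hξ, h⟩ := QND.exists_iteratedDeriv_eq_zero (l := l) (f := fun x => f x - P.eval x)
    (hf.sub hPan) hS hc (by
      intro y hy
      have := Lagrange.eval_interpolate_at_node f hinj hy
      simp only [id] at this
      rw [sub_eq_zero]; exact this.symm)
  refine ⟨ξ, hξ, ?_⟩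
  have h1 : iteratedDeriv l (fun x => f x - P.eval x) ξ =
      iteratedDeriv l f ξ - iteratedDeriv l (fun x => P.eval x) ξ :=
    iteratedDeriv_fun_sub (hf ξ hξ).contDiffAt (hPan ξ hξ).contDiffAt
  have h2 : iteratedDeriv l (fun x => P.eval x) ξ =
      ((Polynomial.derivative^[l]) P).eval ξ := by
    rw [QND.iteratedDeriv_polynomial_eval]
  rw [h1, h2, Lagrange.eval_iterate_derivative_eq_sum hinj hdeg (by omega)] at h
  rw [sub_eq_zero.1 h, mul_div_cancel_left₀ _ (by positivity)]
  refine Finset.sum_congr rfl fun y hy => ?_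
  have := Lagrange.eval_interpolate_at_node f hinj hy
  simp only [id] at this ⊢
  rw [show P.eval y = f y from this]
  simp [hc]

/-- A function whose `l`-th derivative is comparable to a constant, and which is at most `ε` at
`l + 1` points with gaps at least `δ`. -/
theorem QND.abs_le_of_separated {l : ℕ} {f : ℝ → ℝ} {s t A ε δ : ℝ} {S : Finset ℝ}
    (hf : AnalyticOnNhd ℝ f (Set.Icc s t)) (hS : ↑S ⊆ Set.Icc s t) (hc : S.card = l + 1)
    (hA : ∀ x ∈ Set.Icc s t, A / 2 ≤ |iteratedDeriv l f x| ∧ |iteratedDeriv l f x| ≤ 2 * A)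
    (hδ : 0 < δ) (hδst : δ ≤ t - s) (hsep : ∀ y ∈ S, ∀ z ∈ S, y ≠ z → δ ≤ |y - z|)
    (hε : ∀ y ∈ S, |f y| ≤ ε) {x : ℝ} (hx : x ∈ Set.Icc s t) :
    |f x| ≤ (5 * l + 4) * ε * ((t - s) / δ) ^ l := by
  obtain ⟨y₀, hy₀⟩ : S.Nonempty := by rw [← Finset.card_pos]; omega
  have hε0 : 0 ≤ ε := (abs_nonneg _).trans (hε y₀ hy₀)
  set σ := t - s with hσ
  have hσδ : 1 ≤ σ / δ := by rwa [one_le_div hδ]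
  have hσ0 : 0 < σ := hδ.trans_le hδst
  by_cases hxS : x ∈ S
  · have h1 : 1 ≤ (σ / δ) ^ l := one_le_pow₀ hσδ
    have h2 : (1 : ℝ) ≤ 5 * l + 4 := by have : (0 : ℝ) ≤ l := by positivity
                                        linarith
    calc |f x| ≤ 1 * ε * 1 := by simpa using hε x hxS
      _ ≤ _ := by gcongr
  have hdist : ∀ y ∈ Set.Icc s t, ∀ z ∈ Set.Icc s t, |y - z| ≤ σ := by
    intro y hy z hz
    rw [abs_le]; constructor <;> linarith [hy.1, hy.2, hz.1, hz.2]
  have hfac : (0 : ℝ) < l.factorial := by positivity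
  -- a bound for `A`
  have hAb : A / 2 / l.factorial ≤ (l + 1) * (ε / δ ^ l) := by
    obtain ⟨ξ, hξ, h⟩ := QND.exists_dividedDifference_eq hf hS hc
    calc A / 2 / l.factorial ≤ |iteratedDeriv l f ξ| / l.factorial := by
          gcongr; exact (hA ξ hξ).1
      _ = |∑ y ∈ S, f y / ∏ z ∈ S.erase y, (y - z)| := by
          rw [h, abs_div, abs_of_pos hfac]
      _ ≤ ∑ y ∈ S, |f y / ∏ z ∈ S.erase y, (y - z)| := Finset.abs_sum_le_sum_abs _ _
      _ ≤ ∑ y ∈ S, ε / δ ^ l := by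
          refine Finset.sum_le_sum fun y hy => ?_
          rw [abs_div, Finset.abs_prod]
          have : δ ^ l ≤ ∏ z ∈ S.erase y, |y - z| := by
            have hcard : (S.erase y).card = l := by rw [Finset.card_erase_of_mem hy, hc]; simp
            calc δ ^ l = ∏ z ∈ S.erase y, δ := by rw [Finset.prod_const, hcard]
              _ ≤ _ := Finset.prod_le_prod (fun _ _ => hδ.le) fun z hz =>
                hsep y hy z (Finset.mem_of_mem_erase hz) (Finset.ne_of_mem_erase hz).symm
          exact div_le_div₀ hε0 (hε y hy) (by positivity) this
      _ = _ := by rw [Finset.sum_const, hc]; simp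
  -- interpolation at `x` and all nodes but one
  set S' := S.erase y₀ with hS'
  have hS'S : S' ⊆ S := Finset.erase_subset _ _
  have hcard : S'.card = l := by rw [hS', Finset.card_erase_of_mem hy₀, hc]; simp
  have hxS' : x ∉ S' := fun h => hxS (hS'S h)
  obtain ⟨ξ, hξ, h⟩ := QND.exists_dividedDifference_eq (l := l) (S := insert x S') hf
    (by
      rw [Finset.coe_insert]
      exact Set.insert_subset hx fun y hy => hS (hS'S hy))
    (by rw [Finset.card_insert_of_notMem hxS', hcard])
  rw [Finset.sum_insert hxS', Finset.erase_insert hxS'] at h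
  set Q := ∏ z ∈ S', (x - z) with hQ
  have hQ0 : Q ≠ 0 := Finset.prod_ne_zero_iff.2 fun z hz => sub_ne_zero.2 fun h => hxS' (h ▸ hz)
  have hQle : |Q| ≤ σ ^ l := by
    rw [hQ, Finset.abs_prod, ← hcard, ← Finset.prod_const]
    exact Finset.prod_le_prod (fun _ _ => abs_nonneg _) fun z hz => hdist _ hx _ (hS (hS'S hz))
  -- Multiplication by `Q` cancels the factor `y - x`, the only one that `δ` does not bound from
  -- below.
  have hterm : ∀ y ∈ S', |Q * (f y / ∏ z ∈ (insert x S').erase y, (y - z))| ≤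
      ε * (σ / δ) ^ l := by
    intro y hy
    have hxy : x ≠ y := fun h => hxS' (h ▸ hy)
    rw [Finset.erase_insert_of_ne hxy, Finset.prod_insert (by simp [hxS'])]
    have hQy : Q = (x - y) * ∏ z ∈ S'.erase y, (x - z) := by
      rw [hQ, Finset.mul_prod_erase _ _ hy]
    have hxy' : x - y ≠ 0 := sub_ne_zero.2 hxy
    have hyx' : y - x ≠ 0 := sub_ne_zero.2 hxy.symm
    have e1 : Q * (f y / ((y - x) * ∏ z ∈ S'.erase y, (y - z))) =
        -(f y * ∏ z ∈ S'.erase y, ((x - z) / (y - z))) := by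
      rw [hQy, Finset.prod_div_distrib]
      have : x - y = -(y - x) := by ring
      rw [this]
      rw [← div_div, neg_mul, neg_mul, neg_inj]
      field_simp
    rw [e1, abs_neg, abs_mul, Finset.abs_prod]
    have hprod : ∏ z ∈ S'.erase y, |(x - z) / (y - z)| ≤ (σ / δ) ^ l := by
      calc ∏ z ∈ S'.erase y, |(x - z) / (y - z)| ≤ ∏ z ∈ S'.erase y, (σ / δ) := by
            refine Finset.prod_le_prod (fun _ _ => abs_nonneg _) fun z hz => ?_
            rw [abs_div]
            have hz' := Finset.mem_of_mem_erase hz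
            exact div_le_div₀ hσ0.le (hdist _ hx _ (hS (hS'S hz'))) hδ
              (hsep y (hS'S hy) z (hS'S hz') (Finset.ne_of_mem_erase hz).symm)
        _ = (σ / δ) ^ (S'.erase y).card := by rw [Finset.prod_const]
        _ ≤ _ := pow_le_pow_right₀ hσδ (by
            rw [← hcard]; exact Finset.card_le_card (Finset.erase_subset _ _))
    exact mul_le_mul (hε y (hS'S hy)) hprod (Finset.prod_nonneg fun _ _ => abs_nonneg _) hε0
  have hfx : f x = Q * (iteratedDeriv l f ξ / l.factorial) -
      ∑ y ∈ S', Q * (f y / ∏ z ∈ (insert x S').erase y, (y - z)) := by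
    rw [← h, mul_add, ← Finset.mul_sum]
    field_simp
    ring
  calc |f x| ≤ |Q * (iteratedDeriv l f ξ / l.factorial)| +
        |∑ y ∈ S', Q * (f y / ∏ z ∈ (insert x S').erase y, (y - z))| := by
        rw [hfx]; exact abs_sub _ _
    _ ≤ σ ^ l * (4 * ((l + 1) * (ε / δ ^ l))) + ∑ y ∈ S', ε * (σ / δ) ^ l := by
        refine add_le_add ?_ ((Finset.abs_sum_le_sum_abs _ _).trans (Finset.sum_le_sum hterm))
        rw [abs_mul]
        refine mul_le_mul hQle ?_ (abs_nonneg _) (by positivity)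
        rw [abs_div, abs_of_pos hfac]
        calc |iteratedDeriv l f ξ| / l.factorial ≤ 2 * A / l.factorial := by
              gcongr; exact (hA ξ hξ).2
          _ = 4 * (A / 2 / l.factorial) := by ring
          _ ≤ _ := by linarith
    _ = _ := by
        rw [Finset.sum_const, hcard, nsmul_eq_mul, div_pow]
        ring

/-! ### Uniform estimates in a finite-dimensional space of analytic functions. -/

theorem QND.iteratedDeriv_linearCombination {ι : Type*} [Fintype ι] {F : ι → ℝ → ℝ} {x : ℝ}
    (hF : ∀ i, AnalyticAt ℝ (F i) x) (a : ι → ℝ) (j : ℕ) :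
    iteratedDeriv j (fun y => ∑ i, a i * F i y) x = ∑ i, a i * iteratedDeriv j (F i) x := by
  rw [iteratedDeriv_fun_sum (f := fun i y => a i * F i y)
    fun i _ => (analyticAt_const.mul (hF i)).contDiffAt]
  exact Finset.sum_congr rfl fun i _ => by rw [iteratedDeriv_const_mul_field]

/-- In a finite-dimensional space of analytic functions, a function is determined by its jet of a
fixed order at a point. -/
theorem QND.exists_jet_determines {ι : Type*} [Fintype ι] {F : ι → ℝ → ℝ} {U : Set ℝ}
    (hU : IsPreconnected U) (hF : ∀ i, AnalyticOnNhd ℝ (F i) U) {x₀ : ℝ} (hx₀ : x₀ ∈ U) :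
    ∃ N : ℕ, ∀ a : ι → ℝ, (∀ j ≤ N, ∑ i, a i * iteratedDeriv j (F i) x₀ = 0) →
      ∀ x ∈ U, ∑ i, a i * F i x = 0 := by
  let K : ℕ → Submodule ℝ (ι → ℝ) := fun N =>
    { carrier := {a | ∀ j ≤ N, ∑ i, a i * iteratedDeriv j (F i) x₀ = 0}
      zero_mem' := by simp
      add_mem' := by
        intro a b ha hb j hj
        simp [add_mul, Finset.sum_add_distrib, ha j hj, hb j hj]
      smul_mem' := by
        intro c a ha j hj
        simp [mul_assoc, ← Finset.mul_sum, ha j hj] }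
  -- The spaces of coefficients with vanishing jet of order `N` decrease with `N`, so they
  -- stabilise; from then on a vanishing jet forces all derivatives at `x₀` to vanish.
  obtain ⟨N, hN⟩ := IsArtinian.monotone_stabilizes (R := ℝ) (M := ι → ℝ)
    ⟨fun n => OrderDual.toDual (K n), fun m n hmn => OrderDual.toDual_le_toDual.2
      fun a ha j hj => ha j (hj.trans hmn)⟩
  refine ⟨N, fun a ha => ?_⟩
  have hall : ∀ j, ∑ i, a i * iteratedDeriv j (F i) x₀ = 0 := by
    intro j
    have h1 : K N = K (max N j) := hN _ (le_max_left _ _)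
    have h2 : a ∈ K (max N j) := h1 ▸ (show a ∈ K N from ha)
    exact h2 j (le_max_right _ _)
  have han : AnalyticOnNhd ℝ (fun y => ∑ i, a i * F i y) U := fun x hx =>
    Finset.analyticAt_fun_sum _ fun i _ => analyticAt_const.mul (hF i x hx)
  refine han.eqOn_zero_of_preconnected_of_eventuallyEq_zero hU hx₀ ?_
  refine analyticOrderAt_eq_top.1 (ENat.eq_top_iff_forall_ge.2 fun n => ?_)
  rw [natCast_le_analyticOrderAt_iff_iteratedDeriv_eq_zero (han x₀ hx₀)]
  intro j _
  rw [QND.iteratedDeriv_linearCombination fun i => hF i x₀ hx₀]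
  exact hall j

/-- The derivatives of the functions in a finite-dimensional space of analytic functions are
controlled by jets of a fixed order at a point. -/
theorem QND.exists_jet_bound {ι : Type*} [Fintype ι] {F : ι → ℝ → ℝ} {U : Set ℝ}
    (hUo : IsOpen U) (hU : IsPreconnected U) (hF : ∀ i, AnalyticOnNhd ℝ (F i) U)
    {x₀ : ℝ} (hx₀ : x₀ ∈ U) {Z : Set ℝ} (hZ : IsCompact Z) (hZU : Z ⊆ U) :
    ∃ (N : ℕ) (M : ℝ), 0 ≤ M ∧ ∀ a : ι → ℝ, ∀ A : ℝ,
      (∀ j ≤ N, |∑ i, a i * iteratedDeriv j (F i) x₀| ≤ A) → ∀ j ≤ N + 1, ∀ x ∈ Z,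
        |iteratedDeriv j (fun y => ∑ i, a i * F i y) x| ≤ M * A := by
  obtain ⟨N, hN⟩ := QND.exists_jet_determines hU hF hx₀
  let D : ℕ → (ι → ℝ) →ₗ[ℝ] ℝ := fun j =>
    { toFun := fun a => ∑ i, a i * iteratedDeriv j (F i) x₀
      map_add' := by intro a b; simp [add_mul, Finset.sum_add_distrib]
      map_smul' := by intro c a; simp [mul_assoc, ← Finset.mul_sum] }
  let T : (ι → ℝ) →ₗ[ℝ] (Fin (N + 1) → ℝ) := LinearMap.pi fun j => D j
  -- The `F i` may be dependent, so `a` itself is not bounded by its jet. A linear section of `T`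
  -- over its range replaces `a` by bounded coefficients with the same jet, hence with the same
  -- function on `U`.
  obtain ⟨S, hS⟩ := T.rangeRestrict.exists_rightInverse_of_surjective
    (LinearMap.range_eq_top.2 T.surjective_rangeRestrict)
  let S' := LinearMap.toContinuousLinearMap S
  have hbd : ∀ (j : ℕ) (i : ι), ∃ B, ∀ x ∈ Z, ‖iteratedDeriv j (F i) x‖ ≤ B := by
    intro j i
    refine hZ.exists_bound_of_continuousOn ?_
    rw [iteratedDeriv_eq_iterate]
    exact ((hF i).iterated_deriv j).continuousOn.mono hZU
  choose B hB using hbd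
  set Bt := ∑ j ∈ Finset.range (N + 2), ∑ i, |B j i| with hBt
  refine ⟨N, ‖S'‖ * Bt, mul_nonneg S'.opNorm_nonneg
    (Finset.sum_nonneg fun _ _ => Finset.sum_nonneg fun _ _ => abs_nonneg _), ?_⟩
  intro a A hA j hj x hx
  have hA0 : 0 ≤ A := (abs_nonneg _).trans (hA 0 (Nat.zero_le _))
  set a' := S' (T.rangeRestrict a) with ha'
  have hTa : T a' = T a := by
    have := LinearMap.congr_fun hS (T.rangeRestrict a)
    exact congrArg Subtype.val this
  have hnorm : ‖a'‖ ≤ ‖S'‖ * A := by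
    refine (S'.le_opNorm _).trans (mul_le_mul_of_nonneg_left ?_ (norm_nonneg _))
    change ‖T a‖ ≤ A
    rw [pi_norm_le_iff_of_nonneg hA0]
    intro j
    exact hA j (Nat.lt_succ_iff.1 j.2)
  have heq : Set.EqOn (fun y => ∑ i, a i * F i y) (fun y => ∑ i, a' i * F i y) U := by
    intro y hy
    have := hN (a - a') (fun j hj => by
      have h1 := congrFun hTa ⟨j, Nat.lt_succ_iff.2 hj⟩
      change ∑ i, a' i * iteratedDeriv j (F i) x₀ = ∑ i, a i * iteratedDeriv j (F i) x₀ at h1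
      simp only [Pi.sub_apply, sub_mul, Finset.sum_sub_distrib, h1, sub_self]) y hy
    simp only [Pi.sub_apply, sub_mul, Finset.sum_sub_distrib, sub_eq_zero] at this
    exact this
  rw [heq.iteratedDeriv_of_isOpen hUo j (hZU hx),
    QND.iteratedDeriv_linearCombination fun i => hF i x (hZU hx)]
  calc |∑ i, a' i * iteratedDeriv j (F i) x| ≤ ∑ i, |a' i * iteratedDeriv j (F i) x| :=
        Finset.abs_sum_le_sum_abs _ _
    _ ≤ ∑ i, (‖S'‖ * A) * |B j i| := by
        refine Finset.sum_le_sum fun i _ => ?_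
        rw [abs_mul]
        exact mul_le_mul ((norm_le_pi_norm a' i).trans hnorm)
          ((hB j i x hx).trans (le_abs_self _)) (abs_nonneg _) (by positivity)
    _ = (‖S'‖ * A) * ∑ i, |B j i| := by rw [Finset.mul_sum]
    _ ≤ (‖S'‖ * A) * Bt := by
        refine mul_le_mul_of_nonneg_left ?_ (by positivity)
        exact Finset.single_le_sum (f := fun j => ∑ i, |B j i|)
          (fun _ _ => Finset.sum_nonneg fun _ _ => abs_nonneg _) (Finset.mem_range.2 (by omega))
    _ = _ := by ring

/-- Functions in a finite-dimensional space of analytic functions are uniformly good near a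
point: on a short interval they are controlled by their values at separated points. -/
theorem QND.exists_good {ι : Type*} [Fintype ι] {F : ι → ℝ → ℝ} {U : Set ℝ}
    (hUo : IsOpen U) (hU : IsPreconnected U) (hF : ∀ i, AnalyticOnNhd ℝ (F i) U)
    {x₀ : ℝ} (hx₀ : x₀ ∈ U) :
    ∃ (η : ℝ) (L : ℕ) (C : ℝ), 0 < η ∧ 1 ≤ L ∧ 0 < C ∧ Set.Icc (x₀ - η) (x₀ + η) ⊆ U ∧
      ∀ (a : ι → ℝ) (s t δ ε : ℝ) (S : Finset ℝ),
        Set.Icc s t ⊆ Set.Icc (x₀ - η) (x₀ + η) → ↑S ⊆ Set.Icc s t → L + 1 ≤ S.card →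
        0 < δ → δ ≤ t - s → (∀ y ∈ S, ∀ z ∈ S, y ≠ z → δ ≤ |y - z|) →
        (∀ y ∈ S, |∑ i, a i * F i y| ≤ ε) →
        ∀ x ∈ Set.Icc s t, |∑ i, a i * F i x| ≤ C * ε * ((t - s) / δ) ^ L := by
  obtain ⟨η₀, hη₀, hη₀U⟩ : ∃ η₀ > 0, Set.Icc (x₀ - η₀) (x₀ + η₀) ⊆ U := by
    obtain ⟨r, hr, h⟩ := Metric.nhds_basis_closedBall.mem_iff.1 (hUo.mem_nhds hx₀)
    exact ⟨r, hr, by rwa [← Real.closedBall_eq_Icc]⟩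
  obtain ⟨N, M, hM, hjet⟩ := QND.exists_jet_bound hUo hU hF hx₀ isCompact_Icc hη₀U
  have hη1 : 0 < min η₀ (1 / (2 * M + 1)) := lt_min hη₀ (by positivity)
  have hsub : Set.Icc (x₀ - min η₀ (1 / (2 * M + 1))) (x₀ + min η₀ (1 / (2 * M + 1))) ⊆
      Set.Icc (x₀ - η₀) (x₀ + η₀) := Set.Icc_subset_Icc
        (by linarith [min_le_left η₀ (1 / (2 * M + 1))])
        (by linarith [min_le_left η₀ (1 / (2 * M + 1))])
  -- The radius makes the dominant derivative vary by at most half its value at `x₀`. Orders up to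
  -- `N` occur; `N + 1` serves to keep `L` positive, since `α / L` will be an exponent.
  refine ⟨min η₀ (1 / (2 * M + 1)), N + 1, 5 * (N + 1) + 4, hη1, by omega, by positivity,
    hsub.trans hη₀U, ?_⟩
  intro a s t δ ε S hst hS hcard hδ hδst hsep hε x hx
  set η := min η₀ (1 / (2 * M + 1)) with hη
  set f : ℝ → ℝ := fun y => ∑ i, a i * F i y with hf
  have han : AnalyticOnNhd ℝ f U := fun x hx =>
    Finset.analyticAt_fun_sum _ fun i _ => analyticAt_const.mul (hF i x hx)
  obtain ⟨j, hj, hmax⟩ := Finset.exists_max_image (Finset.range (N + 1))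
    (fun j => |∑ i, a i * iteratedDeriv j (F i) x₀|) ⟨0, by simp⟩
  rw [Finset.mem_range] at hj
  set A := |∑ i, a i * iteratedDeriv j (F i) x₀| with hA
  have hA0 : 0 ≤ A := abs_nonneg _
  have hbound := hjet a A fun j' hj' => hmax j' (Finset.mem_range.2 (by omega))
  have hfx₀ : |iteratedDeriv j f x₀| = A := by
    rw [hA, hf, QND.iteratedDeriv_linearCombination fun i => hF i x₀ hx₀]
  have hvar : ∀ y ∈ Set.Icc (x₀ - η) (x₀ + η),
      |iteratedDeriv j f y - iteratedDeriv j f x₀| ≤ A / 2 := by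
    intro y hy
    have hmem : x₀ ∈ Set.Icc (x₀ - η₀) (x₀ + η₀) := ⟨by linarith, by linarith⟩
    have h1 : ‖iteratedDeriv j f y - iteratedDeriv j f x₀‖ ≤ (M * A) * ‖y - x₀‖ := by
      refine Convex.norm_image_sub_le_of_norm_deriv_le (s := Set.Icc (x₀ - η₀) (x₀ + η₀))
        (fun z hz => ?_) (fun z hz => ?_) (convex_Icc _ _) hmem (hsub hy)
      · rw [iteratedDeriv_eq_iterate]
        exact (han.iterated_deriv j z (hη₀U hz)).differentiableAt
      · rw [← iteratedDeriv_succ]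
        exact hbound (j + 1) (by omega) z hz
    have h2 : ‖y - x₀‖ ≤ 1 / (2 * M + 1) := by
      rw [Real.norm_eq_abs, abs_le]
      have := min_le_right η₀ (1 / (2 * M + 1))
      constructor <;> linarith [hy.1, hy.2]
    calc |iteratedDeriv j f y - iteratedDeriv j f x₀| ≤ (M * A) * (1 / (2 * M + 1)) :=
          h1.trans (mul_le_mul_of_nonneg_left h2 (by positivity))
      _ = A * (M / (2 * M + 1)) := by ring
      _ ≤ A * (1 / 2) := by
          refine mul_le_mul_of_nonneg_left ?_ hA0
          rw [div_le_div_iff₀ (by positivity) (by positivity)]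
          linarith
      _ = A / 2 := by ring
  obtain ⟨S', hS', hcard'⟩ := Finset.exists_subset_card_eq (s := S) (n := j + 1) (by omega)
  have hε0 : 0 ≤ ε := by
    obtain ⟨y, hy⟩ : S.Nonempty := by rw [← Finset.card_pos]; omega
    exact (abs_nonneg _).trans (hε y hy)
  have := QND.abs_le_of_separated (f := f) (A := A) (S := S')
    (han.mono (hst.trans (hsub.trans hη₀U)))
    (fun y hy => hS (hS' hy)) hcard' (fun y hy => by
      have h1 := abs_le.1 (hvar y (hst hy))
      have h2 := abs_sub_abs_le_abs_sub (iteratedDeriv j f x₀) (iteratedDeriv j f y)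
      have h3 := abs_sub_abs_le_abs_sub (iteratedDeriv j f y) (iteratedDeriv j f x₀)
      have h4 := hvar y (hst hy)
      rw [abs_sub_comm] at h2
      constructor <;> linarith)
    hδ hδst (fun y hy z hz => hsep y (hS' hy) z (hS' hz)) (fun y hy => hε y (hS' hy)) hx
  refine this.trans ?_
  have h1 : 1 ≤ (t - s) / δ := by rwa [one_le_div hδ]
  have h2 : (j : ℝ) ≤ N + 1 := by exact_mod_cast hj.le
  have h3 : ((t - s) / δ) ^ j ≤ ((t - s) / δ) ^ (N + 1) := pow_le_pow_right₀ h1 hj.le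
  gcongr

/-! ### Sublevel sets and Ahlfors regular measures. -/

/-- A separated subset of maximal cardinality is a `δ`-net. -/
theorem QND.exists_separated_cover {E : Set ℝ} {δ : ℝ} (hδ : 0 < δ) {L : ℕ}
    (hE : ∀ S : Finset ℝ, ↑S ⊆ E → (∀ y ∈ S, ∀ z ∈ S, y ≠ z → δ ≤ |y - z|) → S.card ≤ L) :
    ∃ S : Finset ℝ, ↑S ⊆ E ∧ S.card ≤ L ∧ E ⊆ ⋃ c ∈ S, Metric.closedBall c δ := by
  classical
  let p : ℕ → Prop := fun n => ∃ S : Finset ℝ, ↑S ⊆ E ∧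
    (∀ y ∈ S, ∀ z ∈ S, y ≠ z → δ ≤ |y - z|) ∧ S.card = n
  have hp0 : p 0 := ⟨∅, by simp, by simp, by simp⟩
  have hg : p (Nat.findGreatest p L) := Nat.findGreatest_spec (Nat.zero_le _) hp0
  obtain ⟨S, hS, hsep, hcard⟩ := hg
  refine ⟨S, hS, hE S hS hsep, fun x hx => ?_⟩
  by_contra hcon
  simp only [Set.mem_iUnion, Metric.mem_closedBall, exists_prop, not_exists, not_and, not_le] at hcon
  have hxS : x ∉ S := fun h => by have := hcon x h; rw [dist_self] at this; linarith
  have hins : p (S.card + 1) := by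
    refine ⟨insert x S, ?_, ?_, Finset.card_insert_of_notMem hxS⟩
    · rw [Finset.coe_insert]; exact Set.insert_subset hx hS
    · intro y hy z hz hyz
      rw [Finset.mem_insert] at hy hz
      rcases hy with rfl | hy <;> rcases hz with rfl | hz
      · exact absurd rfl hyz
      · have := hcon z hz; rw [Real.dist_eq] at this; exact this.le
      · have := hcon y hy; rw [Real.dist_eq, abs_sub_comm] at this; exact this.le
      · exact hsep y hy z hz hyz
  have hle : S.card + 1 ≤ L := by
    obtain ⟨S', hS', hsep', hc'⟩ := hins
    rw [← hc']; exact hE S' hS' hsep'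
  have := Nat.le_findGreatest hle hins
  omega

theorem QND.measure_inter_support (μ : Measure ℝ) (E : Set ℝ) : μ (E ∩ μ.support) = μ E :=
  measure_inter_conull' (by
    refine measure_mono_null (fun x hx => hx.2) (Measure.measure_compl_support (μ := μ)))

namespace QND.IsAhlforsRegular

variable {C α ρ₀ : ℝ} {μ : Measure ℝ}

theorem measure_le_of_separated (hμ : QND.IsAhlforsRegular C α ρ₀ μ) {E : Set ℝ} {δ : ℝ}
    (hδ : 0 < δ) (hδρ : δ ≤ ρ₀) {L : ℕ}
    (hE : ∀ S : Finset ℝ, ↑S ⊆ E → (∀ y ∈ S, ∀ z ∈ S, y ≠ z → δ ≤ |y - z|) → S.card ≤ L) :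
    μ E ≤ ENNReal.ofReal (L * C * δ ^ α) := by
  have hC := hμ.one_lt_C
  -- Intersecting with the support puts the centres where the upper regularity bound is available.
  obtain ⟨S, hS, hcard, hcov⟩ := QND.exists_separated_cover (E := E ∩ μ.support) hδ (L := L)
    (fun S hS => hE S (hS.trans Set.inter_subset_left))
  rw [← QND.measure_inter_support]
  calc μ (E ∩ μ.support) ≤ μ (⋃ c ∈ S, Metric.closedBall c δ) := measure_mono hcov
    _ ≤ ∑ c ∈ S, μ (Metric.closedBall c δ) := measure_biUnion_finset_le _ _
    _ ≤ ∑ c ∈ S, ENNReal.ofReal (C * δ ^ α) :=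
        Finset.sum_le_sum fun c hc => hμ.upper c (hS hc).2 δ hδ hδρ
    _ = S.card * ENNReal.ofReal (C * δ ^ α) := by rw [Finset.sum_const, nsmul_eq_mul]
    _ ≤ L * ENNReal.ofReal (C * δ ^ α) := by gcongr
    _ = _ := by
        rw [mul_assoc, ENNReal.ofReal_mul (p := (L : ℝ)) (by positivity), ENNReal.ofReal_natCast]

theorem measure_subset_Icc_le (hμ : QND.IsAhlforsRegular C α ρ₀ μ) {E : Set ℝ} {s t : ℝ}
    (hst : s < t) (hρ : t - s ≤ ρ₀) (hE : E ⊆ Set.Icc s t) :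
    μ E ≤ ENNReal.ofReal (C * (t - s) ^ α) := by
  rw [← QND.measure_inter_support]
  rcases (E ∩ μ.support).eq_empty_or_nonempty with h | ⟨c, hc⟩
  · simp [h]
  · refine (measure_mono (fun x hx => ?_)).trans (hμ.upper c hc.2 (t - s) (by linarith) hρ)
    have h1 := hE hx.1
    have h2 := hE hc.1
    rw [Metric.mem_closedBall, Real.dist_eq, abs_le]
    constructor <;> linarith [h1.1, h1.2, h2.1, h2.2]

theorem measure_singleton (hμ : QND.IsAhlforsRegular C α ρ₀ μ) (x : ℝ) : μ {x} = 0 := by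
  by_cases hx : x ∈ μ.support
  · have hα := hμ.alpha_pos
    have hρ := hμ.scale_pos
    have hlim : Filter.Tendsto (fun r : ℝ => ENNReal.ofReal (C * r ^ α))
        (nhdsWithin 0 (Set.Ioi 0)) (nhds 0) := by
      have h1 : Filter.Tendsto (fun r : ℝ => C * r ^ α) (nhds 0) (nhds (C * 0 ^ α)) :=
        ((Real.continuousAt_rpow_const 0 α (Or.inr hα.le)).tendsto).const_mul C
      rw [Real.zero_rpow hα.ne', mul_zero] at h1
      simpa using (ENNReal.tendsto_ofReal h1).mono_left nhdsWithin_le_nhds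
    refine le_antisymm (ge_of_tendsto hlim ?_) zero_le
    filter_upwards [Ioo_mem_nhdsGT hρ] with r hr
    refine (measure_mono ?_).trans (hμ.upper x hx r hr.1 hr.2.le)
    simpa using hr.1.le
  · exact measure_mono_null (by simpa using hx) (Measure.measure_compl_support (μ := μ))

/-- A function which is controlled by its values at `L + 1` separated points is small only on a
set of small measure. -/
theorem measure_abs_le_le (hμ : QND.IsAhlforsRegular C α ρ₀ μ) {f : ℝ → ℝ} {s t c ε σ : ℝ}
    {L : ℕ} (hL : 1 ≤ L) (hc : 0 < c)
    (hf : ∀ (δ : ℝ) (S : Finset ℝ), ↑S ⊆ Set.Icc s t → L + 1 ≤ S.card → 0 < δ → δ ≤ t - s →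
      (∀ y ∈ S, ∀ z ∈ S, y ≠ z → δ ≤ |y - z|) → (∀ y ∈ S, |f y| ≤ ε) →
      ∀ x ∈ Set.Icc s t, |f x| ≤ c * ε * ((t - s) / δ) ^ L)
    (hst : s < t) (hρ : t - s ≤ ρ₀) (hε : 0 < ε) (hσ : 0 < σ)
    (hx : ∃ x ∈ Set.Icc s t, σ ≤ |f x|) :
    μ {x ∈ Set.Icc s t | |f x| ≤ ε} ≤
      ENNReal.ofReal (L * C * (2 * c) ^ (α / L) * (ε / σ) ^ (α / L) * (t - s) ^ α) := by
  have hC := hμ.one_lt_C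
  have hα := hμ.alpha_pos
  have hh : 0 < t - s := by linarith
  have hL0 : (0 : ℝ) < L := by exact_mod_cast hL
  -- Chosen so that `L + 1` points with gaps `(t - s) * q` would force `|f| ≤ σ / 2` on the whole
  -- interval. If `q > 1` the trivial bound for the interval suffices.
  set q := (2 * c * ε / σ) ^ ((1 : ℝ) / L) with hq
  have hbase : 0 < 2 * c * ε / σ := by positivity
  have hq0 : 0 < q := Real.rpow_pos_of_pos hbase _
  have hqα : (2 * c) ^ (α / L) * (ε / σ) ^ (α / L) = q ^ α := by
    rw [hq, ← Real.rpow_mul hbase.le, ← Real.mul_rpow (by positivity) (by positivity)]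
    congr 1 <;> ring
  have hrew : L * C * (2 * c) ^ (α / L) * (ε / σ) ^ (α / L) * (t - s) ^ α =
      L * C * ((t - s) * q) ^ α := by
    rw [Real.mul_rpow hh.le hq0.le, ← hqα]; ring
  rw [hrew]
  rcases le_or_gt q 1 with h1 | h1
  · have hle : (t - s) * q ≤ t - s := by nlinarith
    refine hμ.measure_le_of_separated (by positivity) (hle.trans hρ) fun S hS hsep => ?_
    by_contra hcard
    obtain ⟨x, hx, hσx⟩ := hx
    have := hf ((t - s) * q) S (fun y hy => (hS hy).1) (by omega) (by positivity) hle hsep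
      (fun y hy => (hS hy).2) x hx
    have hqL : q ^ L = 2 * c * ε / σ := by
      rw [hq, ← Real.rpow_natCast, ← Real.rpow_mul hbase.le, one_div_mul_cancel hL0.ne',
        Real.rpow_one]
    have h2 : ((t - s) / ((t - s) * q)) ^ L = σ / (2 * c * ε) := by
      rw [div_mul_cancel_left₀ hh.ne', inv_pow, hqL, inv_div]
    rw [h2] at this
    have h3 : c * ε * (σ / (2 * c * ε)) = σ / 2 := by field_simp
    linarith
  · refine (hμ.measure_subset_Icc_le hst hρ (fun x hx => hx.1)).trans
      (ENNReal.ofReal_le_ofReal ?_)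
    have h2 : (t - s) ^ α ≤ ((t - s) * q) ^ α :=
      Real.rpow_le_rpow hh.le (by nlinarith) hα.le
    have h3 : (1 : ℝ) ≤ L := by exact_mod_cast hL
    calc C * (t - s) ^ α ≤ C * ((t - s) * q) ^ α := by gcongr
      _ ≤ L * C * ((t - s) * q) ^ α := by
        have : 0 ≤ C * ((t - s) * q) ^ α := by positivity
        nlinarith

end QND.IsAhlforsRegular

/-! ### Marked points and the covering induction. -/

namespace QND

/-- A point is marked if the values there of the members of some flag lie in `[ε, ρ]`, while all
elements compatible with the flag have value at least `ρ`. -/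
def Marked {P : Type*} [PartialOrder P] (f : P → ℝ → ℝ) (A : Set P) (ε ρ x : ℝ) : Prop :=
  ∃ F : Finset P, ↑F ⊆ A ∧ IsChain (· ≤ ·) (F : Set P) ∧
    (∀ s ∈ F, ε ≤ f s x ∧ f s x ≤ ρ) ∧
    ∀ t ∈ A, t ∉ F → (∀ s ∈ F, t < s ∨ s < t) → ρ ≤ f t x

/-- This is the inductive step for flags: a flag among the elements comparable with `s` is completed
by `s`, and whatever is compatible with the larger flag was already compatible with the smaller one.
-/
theorem Marked.of_comparable {P : Type*} [PartialOrder P] {f : P → ℝ → ℝ} {A : Set P}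
    {ε ρ x : ℝ} {s : P} (hs : s ∈ A) (h : Marked f {t ∈ A | t < s ∨ s < t} ε ρ x)
    (hε : ε ≤ f s x) (hρ : f s x ≤ ρ) : Marked f A ε ρ x := by
  classical
  obtain ⟨F, hFA, hF, hFb, hFt⟩ := h
  refine ⟨insert s F, ?_, ?_, ?_, ?_⟩
  · rw [Finset.coe_insert]
    exact Set.insert_subset hs fun t ht => (hFA ht).1
  · rw [Finset.coe_insert]
    exact hF.insert fun t ht _ => ((hFA ht).2.imp le_of_lt le_of_lt).symm
  · intro t ht
    rcases Finset.mem_insert.1 ht with rfl | ht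
    · exact ⟨hε, hρ⟩
    · exact hFb t ht
  · intro t htA ht hcomp
    exact hFt t ⟨htA, hcomp s (Finset.mem_insert_self _ _)⟩
      (fun h => ht (Finset.mem_insert_of_mem h)) fun u hu => hcomp u (Finset.mem_insert_of_mem hu)

/-- The largest ball around `y` on which some member of the family is less than `ρ`. -/
theorem exists_maximal_radius {P : Type*} {f : P → ℝ → ℝ} {A : Set P} {ρ a b y : ℝ}
    (hf : ∀ s ∈ A, ContinuousOn (f s) (Set.Icc a b))
    (hfin : (f '' {s ∈ A | f s y < ρ}).Finite)
    (hsup : ∀ s ∈ A, ∃ x ∈ Set.Icc a b, ρ ≤ f s x) (hy : y ∈ Set.Icc a b)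
    (hne : ∃ s ∈ A, f s y < ρ) :
    ∃ s ∈ A, ∃ r, 0 < r ∧ r ≤ b - a ∧ (∀ x ∈ Set.Icc a b, |x - y| < r → f s x < ρ) ∧
      ∀ t ∈ A, ∃ x ∈ Set.Icc a b, |x - y| ≤ r ∧ ρ ≤ f t x := by
  let Z : (ℝ → ℝ) → Set ℝ := fun h => {x ∈ Set.Icc a b | ρ ≤ h x}
  have hZ : ∀ t ∈ A, ∃ x ∈ Z (f t), Metric.infDist y (Z (f t)) = dist y x := by
    intro t ht
    obtain ⟨x, hx, hxρ⟩ := hsup t ht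
    refine IsCompact.exists_infDist_eq_dist ?_ (show (Z (f t)).Nonempty from ⟨x, hx, hxρ⟩) y
    exact isCompact_Icc.of_isClosed_subset
      ((hf t ht).preimage_isClosed_of_isClosed isClosed_Icc isClosed_Ici) fun x hx => hx.1
  obtain ⟨s₀, hs₀, hs₀y⟩ := hne
  -- The radius is the distance from `y` to the set where the function reaches `ρ`. A maximum needs
  -- finitely many functions only, not finitely many indices.
  obtain ⟨_, ⟨s, ⟨hs, hsy⟩, rfl⟩, hmax⟩ := Set.exists_max_image _
    (fun h => Metric.infDist y (Z h)) hfin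
    ⟨f s₀, Set.mem_image_of_mem f (show s₀ ∈ {s ∈ A | f s y < ρ} from ⟨hs₀, hs₀y⟩)⟩
  obtain ⟨xs, hxs, hdist⟩ := hZ s hs
  refine ⟨s, hs, Metric.infDist y (Z (f s)), ?_, ?_, ?_, ?_⟩
  · rw [hdist, dist_pos]
    rintro rfl
    exact absurd hxs.2 (not_le.2 hsy)
  · rw [hdist, Real.dist_eq, abs_le]
    constructor <;> linarith [hxs.1.1, hxs.1.2, hy.1, hy.2]
  · intro x hx hxr
    by_contra hcon
    have := Metric.infDist_le_dist_of_mem (x := y) (show x ∈ Z (f s) from ⟨hx, not_lt.1 hcon⟩)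
    rw [Real.dist_eq, abs_sub_comm] at this
    linarith
  · intro t ht
    rcases lt_or_ge (f t y) ρ with h | h
    · obtain ⟨xt, hxt, hdt⟩ := hZ t ht
      refine ⟨xt, hxt.1, ?_, hxt.2⟩
      rw [abs_sub_comm, ← Real.dist_eq, ← hdt]
      exact hmax _ ⟨t, ⟨ht, h⟩, rfl⟩
    · exact ⟨y, hy, by simpa using Metric.infDist_nonneg, h⟩

/-- The Besicovitch covering theorem, for a set which is small on a ball around each of its
points. -/
theorem IsAhlforsRegular.exists_measure_le_of_ball {C α ρ₀ : ℝ} {μ : Measure ℝ}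
    (hμ : IsAhlforsRegular C α ρ₀ μ) :
    ∃ D : ℝ, 0 ≤ D ∧ ∀ (E : Set ℝ) (a b κ : ℝ) (r : ℝ → ℝ), a < b → 2 * (b - a) ≤ ρ₀ → 0 ≤ κ →
      E ⊆ Set.Icc a b → E ⊆ μ.support → (∀ y ∈ E, 0 < r y ∧ r y ≤ b - a ∧
        μ (Metric.ball y (r y) ∩ E) ≤ ENNReal.ofReal (κ * (r y) ^ α)) →
      μ E ≤ ENNReal.ofReal (D * κ * (b - a) ^ α) := by
  have hC := hμ.one_lt_C
  obtain ⟨N, τ, hτ, hN⟩ := HasBesicovitchCovering.no_satelliteConfig (α := ℝ)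
  refine ⟨N * (C * (C * 2 ^ α)), by positivity, ?_⟩
  intro E a b κ r hab hρ hκ hEI hEs hE
  rcases E.eq_empty_or_nonempty with rfl | ⟨y₀, hy₀⟩
  · simp
  let q : Besicovitch.BallPackage E ℝ :=
    { c := fun y => y
      r := fun y => r y
      rpos := fun y => (hE y y.2).1
      r_bound := b - a
      r_le := fun y => (hE y y.2).2.1 }
  obtain ⟨s, hdisj, hcov⟩ := Besicovitch.exist_disjoint_covering_families hτ hN q
  have hfam : ∀ i : Fin N, μ (⋃ j ∈ s i, Metric.ball (q.c j) (q.r j) ∩ E) ≤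
      ENNReal.ofReal (C * (C * 2 ^ α) * κ * (b - a) ^ α) := by
    intro i
    have hcount : (s i).Countable := by
      refine (hdisj i).countable_of_nonempty_interior fun j _ => ?_
      exact ⟨q.c j, Metric.ball_subset_interior_closedBall (Metric.mem_ball_self (q.rpos j))⟩
    -- Lower regularity turns `r ^ α` into the mass of a closed ball; these are disjoint within a
    -- family, so their masses add up to at most that of one large ball.
    have hstep : ∀ j : E, μ (Metric.ball (q.c j) (q.r j) ∩ E) ≤
        ENNReal.ofReal (κ * C) * μ (Metric.closedBall (q.c j) (q.r j)) := by
      intro j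
      obtain ⟨h1, h2, h3⟩ := hE j j.2
      refine h3.trans ?_
      calc ENNReal.ofReal (κ * r j ^ α) =
          ENNReal.ofReal (κ * C) * ENNReal.ofReal (C⁻¹ * r j ^ α) := by
            rw [← ENNReal.ofReal_mul (by positivity)]
            congr 1
            field_simp
        _ ≤ _ := by
            gcongr
            exact hμ.lower j (hEs j.2) _ h1 (by linarith)
    calc μ (⋃ j ∈ s i, Metric.ball (q.c j) (q.r j) ∩ E)
        ≤ ∑' j : s i, μ (Metric.ball (q.c j) (q.r j) ∩ E) := measure_biUnion_le μ hcount _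
      _ ≤ ∑' j : s i, ENNReal.ofReal (κ * C) * μ (Metric.closedBall (q.c j) (q.r j)) :=
          ENNReal.tsum_le_tsum fun j => hstep j
      _ = ENNReal.ofReal (κ * C) * μ (⋃ j ∈ s i, Metric.closedBall (q.c j) (q.r j)) := by
          rw [ENNReal.tsum_mul_left, measure_biUnion hcount (hdisj i)
            fun j _ => Metric.isClosed_closedBall.measurableSet]
      _ ≤ ENNReal.ofReal (κ * C) * μ (Metric.closedBall y₀ (2 * (b - a))) := by
          gcongr
          refine Set.iUnion₂_subset fun j _ => Metric.closedBall_subset_closedBall' ?_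
          have h1 := hEI j.2
          have h2 := hEI hy₀
          have h3 : q.r j ≤ b - a := q.r_le j
          have h4 : dist (q.c j) y₀ ≤ b - a := by
            change dist (j : ℝ) y₀ ≤ _
            rw [Real.dist_eq, abs_le]
            constructor <;> linarith [h1.1, h1.2, h2.1, h2.2]
          linarith
      _ ≤ ENNReal.ofReal (κ * C) * ENNReal.ofReal (C * (2 * (b - a)) ^ α) := by
          gcongr
          exact hμ.upper y₀ (hEs hy₀) _ (by linarith) hρ
      _ = _ := by
          rw [← ENNReal.ofReal_mul (by positivity), Real.mul_rpow (by norm_num) (by linarith)]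
          congr 1
          ring
  calc μ E ≤ μ (⋃ i : Fin N, ⋃ j ∈ s i, Metric.ball (q.c j) (q.r j) ∩ E) := by
        refine measure_mono fun y hy => ?_
        have := hcov ⟨⟨y, hy⟩, rfl⟩
        simp only [Set.mem_iUnion] at this ⊢
        obtain ⟨i, j, hj, h⟩ := this
        exact ⟨i, j, hj, h, hy⟩
    _ ≤ ∑ i : Fin N, μ (⋃ j ∈ s i, Metric.ball (q.c j) (q.r j) ∩ E) := by
        refine (measure_iUnion_le _).trans (by rw [tsum_fintype])
    _ ≤ ∑ i : Fin N, ENNReal.ofReal (C * (C * 2 ^ α) * κ * (b - a) ^ α) :=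
        Finset.sum_le_sum fun i _ => hfam i
    _ = _ := by
        rw [Finset.sum_const, Finset.card_univ, Fintype.card_fin, nsmul_eq_mul,
          ← ENNReal.ofReal_natCast, ← ENNReal.ofReal_mul (by positivity)]
        congr 1
        ring

/-- Quantitative nondivergence for a family of good functions indexed by a poset. -/
theorem IsAhlforsRegular.exists_measure_not_marked_le {C α ρ₀ : ℝ} {μ : Measure ℝ}
    (hμ : IsAhlforsRegular C α ρ₀ μ) {P : Type*} [PartialOrder P] {I : Set ℝ} {c γ : ℝ}
    (hc : 0 ≤ c) (j : ℕ) :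
    ∃ D : ℝ, 0 ≤ D ∧ ∀ (f : P → ℝ → ℝ) (A : Set P) (ε ρ : ℝ), 0 < ε → 0 < ρ →
      (∀ F : Finset P, ↑F ⊆ A → IsChain (· ≤ ·) (F : Set P) → F.card ≤ j) →
      (∀ s ∈ A, ContinuousOn (f s) I) →
      (∀ y ∈ I, (f '' {s ∈ A | f s y < ρ}).Finite) →
      (∀ s ∈ A, ∀ a b, a < b → b - a ≤ ρ₀ → Set.Icc a b ⊆ I → (∃ x ∈ Set.Icc a b, ρ ≤ f s x) →
        μ {x ∈ Set.Icc a b | f s x < ε} ≤ ENNReal.ofReal (c * (ε / ρ) ^ γ * (b - a) ^ α)) →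
      ∀ a b, a < b → 2 * (b - a) ≤ ρ₀ → Set.Icc a b ⊆ I →
        (∀ s ∈ A, ∃ x ∈ Set.Icc a b, ρ ≤ f s x) →
        μ {x ∈ Set.Icc a b | ¬ Marked f A ε ρ x} ≤
          ENNReal.ofReal (D * (ε / ρ) ^ γ * (b - a) ^ α) := by
  classical
  have hα := hμ.alpha_pos
  induction j with
  | zero =>
    refine ⟨0, le_rfl, ?_⟩
    intro f A ε ρ hε hρ hchain _ _ _ a b _ _ _ _
    have hA : A = ∅ := by
      rw [Set.eq_empty_iff_forall_notMem]
      intro s hs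
      have := hchain {s} (by simpa using hs) (by simp)
      simp at this
    have hm : {x ∈ Set.Icc a b | ¬ Marked f A ε ρ x} = ∅ := by
      rw [Set.eq_empty_iff_forall_notMem]
      rintro x ⟨_, hx⟩
      exact hx ⟨∅, by simp, by simp, by simp, by simp [hA]⟩
    rw [hm, measure_empty]
    exact zero_le
  | succ j ih =>
    obtain ⟨D, hD, ih⟩ := ih
    obtain ⟨D', hD', hball⟩ := hμ.exists_measure_le_of_ball
    refine ⟨D' * ((D + c) * 2 ^ α), by positivity, ?_⟩
    intro f A ε ρ hε hρ hchain hcont hfin hgood a b hab hbρ hI hsup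
    have hq : 0 ≤ (ε / ρ) ^ γ := by positivity
    rw [← measure_inter_support]
    set E := {x ∈ Set.Icc a b | ¬ Marked f A ε ρ x} ∩ μ.support with hE
    -- If no member were below `ρ` at `y`, the empty flag would mark `y`.
    have hkey : ∀ y ∈ E, ∃ s ∈ A, ∃ r, 0 < r ∧ r ≤ b - a ∧
        (∀ x ∈ Set.Icc a b, |x - y| < r → f s x < ρ) ∧
        ∀ t ∈ A, ∃ x ∈ Set.Icc a b, |x - y| ≤ r ∧ ρ ≤ f t x := by
      intro y hy
      refine exists_maximal_radius (fun s hs => (hcont s hs).mono hI) (hfin y (hI hy.1.1)) hsup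
        hy.1.1 ?_
      by_contra hcon
      push Not at hcon
      exact hy.1.2 ⟨∅, by simp, by simp, by simp, fun t ht _ _ => hcon t ht⟩
    rcases E.eq_empty_or_nonempty with h | ⟨y₀, hy₀⟩
    · rw [h, measure_empty]
      exact zero_le
    have : Nonempty P := ⟨(hkey y₀ hy₀).choose⟩
    choose! s hs r hr hrle hlt hge using hkey
    have := hball E a b ((D + c) * 2 ^ α * (ε / ρ) ^ γ) r hab hbρ (by positivity)
      (fun x hx => hx.1.1) (fun x hx => hx.2) (fun y hy => ⟨hr y hy, hrle y hy, ?_⟩)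
    · refine this.trans (le_of_eq ?_)
      congr 1
      ring
    have hyI : y ∈ Set.Icc a b := hy.1.1
    have hr0 := hr y hy
    set a' := max a (y - r y) with ha'
    set b' := min b (y + r y) with hb'
    have hsub : Set.Icc a' b' ⊆ Set.Icc a b :=
      Set.Icc_subset_Icc (le_max_left _ _) (min_le_left _ _)
    have hmem : ∀ x ∈ Set.Icc a b, |x - y| ≤ r y → x ∈ Set.Icc a' b' := by
      intro x hx hxy
      rw [abs_le] at hxy
      exact ⟨max_le hx.1 (by linarith), le_min hx.2 (by linarith)⟩
    have ha'b' : a' < b' := by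
      rw [ha', hb', lt_min_iff, max_lt_iff, max_lt_iff]
      refine ⟨⟨hab, ?_⟩, ?_, ?_⟩ <;> linarith [hyI.1, hyI.2]
    have hlen : b' - a' ≤ b - a := by linarith [le_max_left a (y - r y), min_le_left b (y + r y)]
    have hlen2 : b' - a' ≤ 2 * r y := by
      linarith [le_max_right a (y - r y), min_le_right b (y + r y)]
    have hfull : ∀ t ∈ A, ∃ x ∈ Set.Icc a' b', ρ ≤ f t x := fun t ht => by
      obtain ⟨x, hx, hxr, hxρ⟩ := hge y hy t ht
      exact ⟨x, hmem x hx hxr, hxρ⟩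
    -- Chains in `B` can be lengthened by `s y`, so they have at most `j` elements.
    set B := {t ∈ A | t < s y ∨ s y < t} with hB
    have hBA : B ⊆ A := fun t ht => ht.1
    have h1 : μ {x ∈ Set.Icc a' b' | ¬ Marked f B ε ρ x} ≤
        ENNReal.ofReal (D * (ε / ρ) ^ γ * (b' - a') ^ α) := by
      refine ih f B ε ρ hε hρ ?_ (fun t ht => hcont t ht.1) ?_ (fun t ht => hgood t ht.1) a' b'
        ha'b' (by linarith) (hsub.trans hI) fun t ht => hfull t ht.1
      · intro F hF hFc
        have hsF : s y ∉ F := fun h => (hF h).2.elim (lt_irrefl _) (lt_irrefl _)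
        have := hchain (insert (s y) F)
          (by rw [Finset.coe_insert]; exact Set.insert_subset (hs y hy) (hF.trans hBA))
          (by
            rw [Finset.coe_insert]
            exact hFc.insert fun t ht _ => ((hF ht).2.imp le_of_lt le_of_lt).symm)
        rw [Finset.card_insert_of_notMem hsF] at this
        omega
      · intro z hz
        exact (hfin z hz).subset (Set.image_mono fun t ht => ⟨ht.1.1, ht.2⟩)
    have h2 : μ {x ∈ Set.Icc a' b' | f (s y) x < ε} ≤
        ENNReal.ofReal (c * (ε / ρ) ^ γ * (b' - a') ^ α) :=
      hgood _ (hs y hy) a' b' ha'b' (by linarith) (hsub.trans hI) (hfull _ (hs y hy))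
    have hpow : (b' - a') ^ α ≤ 2 ^ α * r y ^ α := by
      rw [← Real.mul_rpow (by norm_num) hr0.le]
      exact Real.rpow_le_rpow (by linarith) hlen2 hα.le
    calc μ (Metric.ball y (r y) ∩ E)
        ≤ μ ({x ∈ Set.Icc a' b' | ¬ Marked f B ε ρ x} ∪ {x ∈ Set.Icc a' b' | f (s y) x < ε}) := by
          refine measure_mono ?_
          rintro x ⟨hxb, ⟨hxI, hxm⟩, _⟩
          rw [Metric.mem_ball, Real.dist_eq] at hxb
          have hx' := hmem x hxI hxb.le
          by_contra hcon
          simp only [Set.mem_union, Set.mem_ofPred_eq, not_or, not_and, not_not, not_lt] at hcon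
          exact hxm (Marked.of_comparable (hs y hy) (hcon.1 hx') (hcon.2 hx') (hlt y hy x hxI hxb).le)
      _ ≤ ENNReal.ofReal (D * (ε / ρ) ^ γ * (b' - a') ^ α) +
          ENNReal.ofReal (c * (ε / ρ) ^ γ * (b' - a') ^ α) :=
          (measure_union_le _ _).trans (add_le_add h1 h2)
      _ = ENNReal.ofReal ((D + c) * (ε / ρ) ^ γ * (b' - a') ^ α) := by
          have : 0 ≤ (b' - a') ^ α := Real.rpow_nonneg (by linarith) _
          rw [← ENNReal.ofReal_add (by positivity) (by positivity)]
          congr 1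
          ring
      _ ≤ _ := by
          refine ENNReal.ofReal_le_ofReal ?_
          calc (D + c) * (ε / ρ) ^ γ * (b' - a') ^ α
              ≤ (D + c) * (ε / ρ) ^ γ * (2 ^ α * r y ^ α) := by gcongr
            _ = _ := by ring

end QND

/-! ### Minors and optimal integer bases. -/

namespace QND

/-- The expansion of an alternating map in terms of the minors of its arguments. -/
theorem factorial_smul_alternatingMap {𝕜 M : Type*} [CommRing 𝕜] [AddCommGroup M] [Module 𝕜 M]
    {r k : ℕ} (A : (Fin k → 𝕜) [⋀^Fin r]→ₗ[𝕜] M) (v : Fin r → Fin k → 𝕜) :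
    (r.factorial : 𝕜) • A v = ∑ f : Fin r → Fin k,
      (Matrix.of fun i j => v i (f j)).det • A fun j => Pi.single (f j) 1 := by
  have hexp : A v = ∑ f : Fin r → Fin k, (∏ i, v i (f i)) • A fun j => Pi.single (f j) 1 := by
    have hv : v = fun i => ∑ j, v i j • (Pi.single j 1 : Fin k → 𝕜) := by
      ext i j
      simp [Finset.sum_apply, Pi.single_apply]
    conv_lhs => rw [hv]
    rw [← AlternatingMap.coe_multilinearMap, MultilinearMap.map_sum]
    exact Finset.sum_congr rfl fun f _ => MultilinearMap.map_smul_univ _ _ _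
  -- Summing these expansions over all `σ` assembles the products into determinants. The factor `r!`
  -- is the price of indexing by all maps instead of increasing ones.
  have hperm : ∀ σ : Equiv.Perm (Fin r), A v = ∑ f : Fin r → Fin k,
      ((Equiv.Perm.sign σ : ℤ) * ∏ i, v i (f (σ i)) : 𝕜) • A fun j => Pi.single (f j) 1 := by
    intro σ
    rw [hexp, ← Equiv.sum_comp (Equiv.arrowCongr σ.symm (Equiv.refl (Fin k)))]
    refine Finset.sum_congr rfl fun f _ => ?_
    have h1 : A (fun j => (Pi.single (f (σ j)) 1 : Fin k → 𝕜)) =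
        Equiv.Perm.sign σ • A fun j => Pi.single (f j) 1 :=
      A.map_perm (fun j => Pi.single (f j) 1) σ
    simp only [Equiv.arrowCongr_apply, Equiv.coe_refl, Equiv.symm_symm, Function.comp_apply, id]
    rw [h1, mul_comm, mul_smul]
    congr 1
    rw [Units.smul_def, Int.cast_smul_eq_zsmul]
  calc (r.factorial : 𝕜) • A v = ∑ _σ : Equiv.Perm (Fin r), A v := by
        rw [Finset.sum_const, Finset.card_univ, Fintype.card_perm, Fintype.card_fin,
          Nat.cast_smul_eq_nsmul]
    _ = ∑ σ : Equiv.Perm (Fin r), ∑ f : Fin r → Fin k,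
        ((Equiv.Perm.sign σ : ℤ) * ∏ i, v i (f (σ i)) : 𝕜) • A fun j => Pi.single (f j) 1 :=
        Finset.sum_congr rfl fun σ _ => hperm σ
    _ = _ := by
        rw [Finset.sum_comm]
        refine Finset.sum_congr rfl fun f _ => ?_
        rw [← Finset.sum_smul, ← Matrix.det_transpose, Matrix.det_apply']
        rfl

/-- The vector of the `r × r` minors of the tuple `H v₁, …, H v_r`. -/
def minors {r k : ℕ} (H : Matrix (Fin k) (Fin k) ℝ) (v : Fin r → Fin k → ℝ) :
    (Fin r → Fin k) → ℝ :=
  fun c => (Matrix.of fun i j => H.mulVec (v i) (c j)).det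

/-- A minor, as an alternating map. -/
noncomputable def minorMap {𝕜 : Type*} [CommRing 𝕜] {r k : ℕ} (H : Matrix (Fin k) (Fin k) 𝕜)
    (c : Fin r → Fin k) : (Fin k → 𝕜) [⋀^Fin r]→ₗ[𝕜] 𝕜 :=
  Matrix.detRowAlternating.compLinearMap (LinearMap.funLeft 𝕜 𝕜 c ∘ₗ H.mulVecLin)

theorem minorMap_apply {𝕜 : Type*} [CommRing 𝕜] {r k : ℕ} (H : Matrix (Fin k) (Fin k) 𝕜)
    (c : Fin r → Fin k) (v : Fin r → Fin k → 𝕜) :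
    minorMap H c v = (Matrix.of fun i j => H.mulVec (v i) (c j)).det := rfl

/-- A form of the Cauchy–Binet formula. -/
theorem factorial_mul_minors {r k : ℕ} (H : Matrix (Fin k) (Fin k) ℝ) (v : Fin r → Fin k → ℝ)
    (c : Fin r → Fin k) :
    (r.factorial : ℝ) * minors H v c = ∑ f : Fin r → Fin k,
      (Matrix.of fun i j => v i (f j)).det * (Matrix.of fun i j => H (c j) (f i)).det := by
  have := factorial_smul_alternatingMap (minorMap H c) v
  rw [smul_eq_mul] at this
  refine this.trans (Finset.sum_congr rfl fun f _ => ?_)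
  rw [smul_eq_mul, minorMap_apply]
  congr 3
  ext i j
  simp

/-- The integer vector `p`, with real coordinates. -/
def toReal {r k : ℕ} (p : Fin r → Fin k → ℤ) : Fin r → Fin k → ℝ := fun i j => (p i j : ℝ)

/-- The integer vector `p`, with rational coordinates. -/
def toRat {r k : ℕ} (p : Fin r → Fin k → ℤ) : Fin r → Fin k → ℚ := fun i j => (p i j : ℚ)

/-- The matrix `T` acts on tuples by taking linear combinations of their members. -/
theorem minors_linearCombination {r k : ℕ} (H : Matrix (Fin k) (Fin k) ℝ)
    (T : Matrix (Fin r) (Fin r) ℝ) (v w : Fin r → Fin k → ℝ) (h : ∀ i, w i = ∑ l, T i l • v l) :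
    minors H w = T.det • minors H v := by
  ext c
  simp only [minors, Pi.smul_apply, smul_eq_mul]
  rw [← Matrix.det_mul]
  congr 1
  ext i j
  simp [h, Matrix.mul_apply, Matrix.mulVec_sum, Matrix.mulVec_smul, Finset.sum_apply]

theorem norm_minors_cons_le {r k : ℕ} (H : Matrix (Fin k) (Fin k) ℝ) (w : Fin k → ℝ)
    (v : Fin r → Fin k → ℝ) :
    ‖minors H (Fin.cons w v : Fin (r + 1) → Fin k → ℝ)‖ ≤
      (r + 1) * ‖H.mulVec w‖ * ‖minors H v‖ := by
  rw [pi_norm_le_iff_of_nonneg (by positivity)]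
  intro c
  rw [minors, Matrix.det_succ_row_zero]
  refine (norm_sum_le _ _).trans ?_
  calc _ ≤ ∑ _j : Fin (r + 1), ‖H.mulVec w‖ * ‖minors H v‖ := by
        refine Finset.sum_le_sum fun j _ => ?_
        rw [norm_mul, norm_mul, norm_pow, norm_neg, norm_one, one_pow, one_mul]
        refine mul_le_mul ?_ ?_ (norm_nonneg _) (norm_nonneg _)
        · exact norm_le_pi_norm (H.mulVec w) (c j)
        · exact norm_le_pi_norm (minors H v) fun l => c (j.succAbove l)
    _ = _ := by rw [Finset.sum_const]; simp; ring

theorem norm_minors_le_one_of_eq_zero {r k : ℕ} (hr : r = 0) (H : Matrix (Fin k) (Fin k) ℝ)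
    (v : Fin r → Fin k → ℝ) : ‖minors H v‖ ≤ 1 := by
  subst hr
  rw [pi_norm_le_iff_of_nonneg zero_le_one]
  intro c
  simp [minors]

/-- A left inverse of the map given by `p` yields an alternating form with value 1 at `p`; its
expansion in minors cannot vanish termwise. -/
theorem exists_minor_ne_zero {r k : ℕ} {p : Fin r → Fin k → ℤ}
    (hp : LinearIndependent ℚ (toRat p)) :
    ∃ f : Fin r → Fin k, (Matrix.of fun i j => p i (f j)).det ≠ 0 := by
  by_contra! hcon
  obtain ⟨S, hS⟩ := (Fintype.linearCombination ℚ (toRat p)).exists_leftInverse_of_injective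
    (LinearMap.ker_eq_bot.2 (by
      have := hp.fintypeLinearCombination_injective
      exact this))
  let A : (Fin k → ℚ) [⋀^Fin r]→ₗ[ℚ] ℚ := Matrix.detRowAlternating.compLinearMap S
  have h1 : A (toRat p) = 1 := by
    have : ∀ i, S (toRat p i) = Pi.single i 1 := fun i => by
      have := LinearMap.congr_fun hS (Pi.single i 1)
      simpa [Fintype.linearCombination_apply_single] using this
    have hI : (Matrix.of fun i => S (toRat p i)) = 1 := by
      ext i j
      rw [Matrix.of_apply, this, Matrix.one_apply, Pi.single_apply]
      simp only [eq_comm]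
    change Matrix.det (Matrix.of fun i => S (toRat p i)) = 1
    rw [hI, Matrix.det_one]
  have h2 := factorial_smul_alternatingMap A (toRat p)
  rw [h1, Finset.sum_eq_zero] at h2
  · simp [Nat.factorial_ne_zero] at h2
  · intro f _
    have : (Matrix.of fun i j => toRat p i (f j)).det = 0 := by
      have h3 := congrArg (Int.cast : ℤ → ℚ) (hcon f)
      rw [Int.cast_det] at h3
      simpa [toRat, Matrix.map] using h3
    rw [this, zero_smul]

/-- A rational subspace has a basis of integer vectors whose minors are minimal. -/
theorem exists_minimal_integer_basis {k : ℕ} (V : Submodule ℚ (Fin k → ℚ)) :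
    ∃ p : Fin (Module.finrank ℚ V) → Fin k → ℤ, LinearIndependent ℚ (toRat p) ∧
      (∀ i, toRat p i ∈ V) ∧
      ∀ (r : ℕ) (q : Fin r → Fin k → ℤ), r = Module.finrank ℚ V → LinearIndependent ℚ (toRat q) →
        (∀ i, toRat q i ∈ V) → ∀ H : Matrix (Fin k) (Fin k) ℝ,
          ‖minors H (toReal p)‖ ≤ ‖minors H (toReal q)‖ := by
  classical
  set r₀ := Module.finrank ℚ V with hr₀
  let 𝒯 : Set (Fin r₀ → Fin k → ℤ) :=
    {p | LinearIndependent ℚ (toRat p) ∧ ∀ i, toRat p i ∈ V}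
  let size : (Fin r₀ → Fin k → ℤ) → ℕ := fun p =>
    ∑ c : Fin r₀ → Fin k, (Matrix.of fun i j => p i (c j)).det.natAbs
  have hne : 𝒯.Nonempty := by
    let b := Module.finBasis ℚ V
    obtain ⟨d, hd⟩ := IsLocalization.exist_integer_multiples_of_finite (nonZeroDivisors ℤ)
      (fun ij : Fin r₀ × Fin k => (b ij.1 : Fin k → ℚ) ij.2)
    choose z hz using hd
    have hd0 : ((d : ℤ) : ℚ) ≠ 0 := by
      exact_mod_cast nonZeroDivisors.coe_ne_zero d
    have heq : toRat (fun i j => z (i, j)) = fun i => ((d : ℤ) : ℚ) • (b i : Fin k → ℚ) := by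
      ext i j
      have := hz (i, j)
      simp only [toRat, Pi.smul_apply, smul_eq_mul]
      simpa using this
    refine ⟨fun i j => z (i, j), ?_, ?_⟩
    · rw [heq]
      have hb : LinearIndependent ℚ fun i => (b i : Fin k → ℚ) :=
        b.linearIndependent.map' V.subtype V.ker_subtype
      exact hb.units_smul fun _ => Units.mk0 _ hd0
    · intro i
      rw [heq]
      exact V.smul_mem _ (b i).2
  -- Any other integer basis is a rational matrix `T` times `p`, and all minors scale by `det T`.
  -- Minimality of this one integer size gives `|det T| ≥ 1`, hence minimality for every `H` at
  -- once.
  obtain ⟨p, hp, hmin⟩ := exists_minimalFor_of_wellFoundedLT (· ∈ 𝒯) size hne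
  refine ⟨p, hp.1, hp.2, ?_⟩
  intro r q hr hq hqV H
  subst hr
  have hspan : Submodule.span ℚ (Set.range (toRat p)) = V := by
    refine Submodule.eq_of_le_of_finrank_eq (Submodule.span_le.2 ?_) ?_
    · rintro _ ⟨i, rfl⟩
      exact hp.2 i
    · rw [finrank_span_eq_card hp.1, Fintype.card_fin]
  have hT : ∀ i, ∃ t : Fin r₀ → ℚ, ∑ l, t l • toRat p l = toRat q i := fun i => by
    rw [← Submodule.mem_span_range_iff_exists_fun, hspan]
    exact hqV i
  choose T hT using hT
  have hdet : ∀ c : Fin r₀ → Fin k, (((Matrix.of fun i j => q i (c j)).det : ℤ) : ℚ) =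
      (Matrix.of T).det * ((Matrix.of fun i j => p i (c j)).det : ℤ) := by
    intro c
    rw [Int.cast_det, Int.cast_det, ← Matrix.det_mul]
    congr 1
    ext i j
    have := congrFun (hT i) (c j)
    simp only [Finset.sum_apply, Pi.smul_apply, smul_eq_mul, toRat] at this
    simpa [Matrix.mul_apply] using this.symm
  have hsize : (size q : ℚ) = |(Matrix.of T).det| * size p := by
    simp only [size, Nat.cast_sum, Finset.mul_sum]
    refine Finset.sum_congr rfl fun c _ => ?_
    rw [Nat.cast_natAbs, Nat.cast_natAbs, Int.cast_abs, Int.cast_abs, hdet c, abs_mul]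
  have hpos : 0 < size p := by
    obtain ⟨f, hf⟩ := exists_minor_ne_zero hp.1
    exact (Int.natAbs_pos.2 hf).trans_le
      (Finset.single_le_sum (f := fun c => (Matrix.of fun i j => p i (c j)).det.natAbs)
        (fun _ _ => Nat.zero_le _) (Finset.mem_univ f))
  have hle : size p ≤ size q := by
    rcases le_total (size p) (size q) with h | h
    · exact h
    · exact hmin ⟨hq, hqV⟩ h
  have hdet1 : 1 ≤ |(Matrix.of T).det| := by
    have h1 : (size p : ℚ) ≤ |(Matrix.of T).det| * size p := by
      rw [← hsize]; exact_mod_cast hle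
    have h2 : (0 : ℚ) < size p := by exact_mod_cast hpos
    exact le_of_mul_le_mul_right (by rwa [one_mul]) h2
  have hreal := minors_linearCombination H (Matrix.of fun i l => (T i l : ℝ)) (toReal p) (toReal q)
    (fun i => by
      ext j
      have := congrArg (Rat.cast : ℚ → ℝ) (congrFun (hT i) j)
      simp only [Finset.sum_apply, Pi.smul_apply, smul_eq_mul, toRat] at this
      push_cast at this
      simpa [toReal] using this.symm)
  have hdetR : (Matrix.of fun i l => (T i l : ℝ)).det = (((Matrix.of T).det : ℚ) : ℝ) := by
    have := RingHom.map_det (Rat.castHom ℝ) (Matrix.of T)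
    simpa [Matrix.map] using this.symm
  rw [hreal, norm_smul, hdetR, Real.norm_eq_abs]
  have : (1 : ℝ) ≤ |(((Matrix.of T).det : ℚ) : ℝ)| := by exact_mod_cast hdet1
  exact le_mul_of_one_le_left (norm_nonneg _) this

/-- In full rank the minor is a nonzero integer determinant; this handles the whole space, which is
not a proper subspace. -/
theorem one_le_norm_minors {r k : ℕ} (hr : r = k) {q : Fin r → Fin k → ℤ}
    (hq : LinearIndependent ℚ (toRat q)) {H : Matrix (Fin k) (Fin k) ℝ} (hH : H.det = 1) :
    1 ≤ ‖minors H (toReal q)‖ := by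
  subst hr
  refine le_trans ?_ (norm_le_pi_norm (minors H (toReal q)) id)
  have h1 : minors H (toReal q) id = ((Matrix.of q).det : ℤ) := by
    have : (Matrix.of fun i j => H.mulVec (toReal q i) (id j)) =
        (Matrix.of (toReal q)) * H.transpose := by
      ext i j
      simp [Matrix.mul_apply, Matrix.mulVec, dotProduct, mul_comm]
    rw [minors, this, Matrix.det_mul, Matrix.det_transpose, hH, mul_one, Int.cast_det]
    rfl
  have h2 : (Matrix.of q).det ≠ 0 := by
    have : IsUnit (Matrix.of (toRat q)) := Matrix.linearIndependent_rows_iff_isUnit.1 hq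
    rw [Matrix.isUnit_iff_isUnit_det, isUnit_iff_ne_zero] at this
    intro h
    apply this
    have h3 := congrArg (Int.cast : ℤ → ℚ) h
    rw [Int.cast_det] at h3
    change (Matrix.of fun i j => (q i j : ℚ)).det = 0
    simpa [Matrix.map] using h3
  rw [h1, Real.norm_eq_abs]
  exact_mod_cast Int.one_le_abs h2

end QND

/-! ### Covolumes of rational subspaces and short vectors. -/

namespace QND

/-- Integer vectors forming a basis of a rational subspace, with minimal minors. -/
noncomputable def subspaceBasis {k : ℕ} (V : Submodule ℚ (Fin k → ℚ)) :
    Fin (Module.finrank ℚ V) → Fin k → ℤ :=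
  (exists_minimal_integer_basis V).choose

/-- The covolume of the lattice of integer points of a rational subspace, after applying `H`. -/
noncomputable def covol {k : ℕ} (H : Matrix (Fin k) (Fin k) ℝ) (V : Submodule ℚ (Fin k → ℚ)) : ℝ :=
  ‖minors H (toReal (subspaceBasis V))‖

theorem linearIndependent_subspaceBasis {k : ℕ} (V : Submodule ℚ (Fin k → ℚ)) :
    LinearIndependent ℚ (toRat (subspaceBasis V)) :=
  (exists_minimal_integer_basis V).choose_spec.1

theorem subspaceBasis_mem {k : ℕ} (V : Submodule ℚ (Fin k → ℚ)) (i) :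
    toRat (subspaceBasis V) i ∈ V :=
  (exists_minimal_integer_basis V).choose_spec.2.1 i

theorem covol_le {k r : ℕ} (H : Matrix (Fin k) (Fin k) ℝ) (V : Submodule ℚ (Fin k → ℚ))
    {q : Fin r → Fin k → ℤ} (hr : r = Module.finrank ℚ V) (hq : LinearIndependent ℚ (toRat q))
    (hqV : ∀ i, toRat q i ∈ V) : covol H V ≤ ‖minors H (toReal q)‖ :=
  (exists_minimal_integer_basis V).choose_spec.2.2 r q hr hq hqV H

/-- The nonzero proper rational subspaces. -/
def properSubspaces (k : ℕ) : Set (Submodule ℚ (Fin k → ℚ)) := {V | V ≠ ⊥ ∧ V ≠ ⊤}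

theorem card_le_of_isChain {k : ℕ} (F : Finset (Submodule ℚ (Fin k → ℚ)))
    (hF : IsChain (· ≤ ·) (F : Set (Submodule ℚ (Fin k → ℚ)))) : F.card ≤ k + 1 := by
  have := Finset.card_le_card_of_injOn (s := F) (t := Finset.range (k + 1))
    (fun V => Module.finrank ℚ V) (fun V _ => by
      have h := Submodule.finrank_le V
      rw [Module.finrank_fin_fun] at h
      simpa using Nat.lt_succ_iff.2 h)
    (fun V hV W hW h => by
      rcases hF.total hV hW with hle | hle
      · exact Submodule.eq_of_le_of_finrank_eq hle h
      · exact (Submodule.eq_of_le_of_finrank_eq hle h.symm).symm)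
  simpa using this

/-- At a marked point the lattice has no short vectors. -/
theorem le_norm_mulVec_of_marked {k : ℕ} {H : ℝ → Matrix (Fin k) (Fin k) ℝ} {ε ρ x : ℝ}
    (hH : (H x).det = 1) (hερ : ε ≤ ρ) (hρ : ρ ≤ 1)
    (hm : Marked (fun V y => covol (H y) V) (properSubspaces k) ε ρ x)
    {w : Fin k → ℤ} (hw : w ≠ 0) : ε ≤ k * ‖(H x).mulVec fun j => (w j : ℝ)‖ := by
  classical
  obtain ⟨F, hFA, hF, hFb, hFt⟩ := hm
  set w' : Fin k → ℚ := fun j => (w j : ℚ) with hw'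
  have hw'0 : w' ≠ 0 := fun h => hw (by
    ext j
    have := congrFun h j
    simpa [hw'] using this)
  -- `V` is the largest flag member not containing `w`, or `⊥`, whose empty minor is 1. Then `V +
  -- ⟨w⟩` lies below the members containing `w` and strictly above the others, so it is in the flag,
  -- compatible with it, or everything.
  obtain ⟨V, hwV, hV1, hV2, hV3⟩ : ∃ V : Submodule ℚ (Fin k → ℚ), w' ∉ V ∧
      covol (H x) V ≤ 1 ∧ (∀ W ∈ F, w' ∉ W → W ≤ V) ∧ ∀ W ∈ F, w' ∈ W → V ≤ W := by
    rcases (F.filter fun W => w' ∉ W).eq_empty_or_nonempty with h | h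
    · refine ⟨⊥, by simpa using hw'0, norm_minors_le_one_of_eq_zero (finrank_bot _ _) _ _, ?_,
        fun _ _ _ => bot_le⟩
      intro W hW hwW
      have : W ∈ F.filter fun W => w' ∉ W := Finset.mem_filter.2 ⟨hW, hwW⟩
      rw [h] at this
      simp at this
    · obtain ⟨V, hV⟩ := (F.filter fun W => w' ∉ W).exists_maximal h
      obtain ⟨hVF, hwV⟩ := Finset.mem_filter.1 hV.1
      refine ⟨V, hwV, (hFb V hVF).2.trans hρ, ?_, ?_⟩
      · intro W hW hwW
        rcases hF.total hW hVF with hle | hle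
        · exact hle
        · exact hV.2 (Finset.mem_filter.2 ⟨hW, hwW⟩) hle
      · intro W hW hwW
        rcases hF.total hW hVF with hle | hle
        · exact absurd (hle hwW) hwV
        · exact hle
  set W := V ⊔ Submodule.span ℚ {w'} with hWdef
  have hwW : w' ∈ W := (le_sup_right : _ ≤ W) (Submodule.mem_span_singleton_self _)
  have hVW : V ≤ W := le_sup_left
  have hrank : Module.finrank ℚ W = Module.finrank ℚ V + 1 :=
    Submodule.finrank_sup_span_singleton hwV
  set q : Fin (Module.finrank ℚ V + 1) → Fin k → ℤ := Fin.cons w (subspaceBasis V) with hq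
  have hqrat : toRat q = Fin.cons w' (toRat (subspaceBasis V)) := by
    ext i j
    refine Fin.cases ?_ (fun i => ?_) i <;> simp [toRat, hq, hw']
  have hqreal : toReal q = Fin.cons (fun j => (w j : ℝ)) (toReal (subspaceBasis V)) := by
    ext i j
    refine Fin.cases ?_ (fun i => ?_) i <;> simp [toReal, hq]
  have hqli : LinearIndependent ℚ (toRat q) := by
    rw [hqrat, linearIndependent_finCons]
    refine ⟨linearIndependent_subspaceBasis V, fun h => hwV ?_⟩
    refine (Submodule.span_le.2 ?_ : Submodule.span ℚ _ ≤ V) h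
    rintro _ ⟨i, rfl⟩
    exact subspaceBasis_mem V i
  have hqW : ∀ i, toRat q i ∈ W := by
    intro i
    rw [hqrat]
    refine Fin.cases ?_ (fun i => ?_) i
    · simpa using hwW
    · simpa using hVW (subspaceBasis_mem V i)
  have hεq : ε ≤ ‖minors (H x) (toReal q)‖ := by
    by_cases hWtop : W = ⊤
    · refine (hερ.trans hρ).trans (one_le_norm_minors ?_ hqli hH)
      rw [← hrank, hWtop, finrank_top, Module.finrank_fin_fun]
    · have hWA : W ∈ properSubspaces k := by
        refine ⟨fun h => hw'0 ?_, hWtop⟩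
        rw [h] at hwW
        simpa using hwW
      refine le_trans ?_ (covol_le (H x) W hrank.symm hqli hqW)
      by_cases hWF : W ∈ F
      · exact (hFb W hWF).1
      · refine hερ.trans (hFt W hWA hWF fun W' hW' => ?_)
        by_cases hwW' : w' ∈ W'
        · left
          refine lt_of_le_of_ne (sup_le (hV3 W' hW' hwW') ?_) fun h => hWF (h ▸ hW')
          rwa [Submodule.span_singleton_le_iff_mem]
        · right
          exact lt_of_le_of_ne ((hV2 W' hW' hwW').trans hVW) fun h => hwW' (h ▸ hwW)
  have hk : ((Module.finrank ℚ V : ℕ) : ℝ) + 1 ≤ k := by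
    have h := Submodule.finrank_le W
    rw [Module.finrank_fin_fun, hrank] at h
    exact_mod_cast h
  refine hεq.trans ?_
  rw [hqreal]
  refine (norm_minors_cons_le _ _ _).trans ?_
  calc _ ≤ ((Module.finrank ℚ V : ℕ) + 1) * ‖(H x).mulVec fun j => (w j : ℝ)‖ * 1 := by
        gcongr
        exact hV1
    _ ≤ _ := by rw [mul_one]; gcongr

/-- The minors of `v` are bounded in terms of those of `H v`. -/
theorem exists_norm_minors_one_le {k : ℕ} {H : Matrix (Fin k) (Fin k) ℝ} (hH : IsUnit H.det)
    (r : ℕ) : ∃ M : ℝ, ∀ v : Fin r → Fin k → ℝ, ‖minors 1 v‖ ≤ M * ‖minors H v‖ := by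
  set B := ∑ c : Fin r → Fin k, ∑ f : Fin r → Fin k, ‖(Matrix.of fun i j => H⁻¹ (c j) (f i)).det‖
    with hB
  have hB0 : 0 ≤ B := Finset.sum_nonneg fun _ _ => Finset.sum_nonneg fun _ _ => norm_nonneg _
  refine ⟨B, fun v => ?_⟩
  rw [pi_norm_le_iff_of_nonneg (by positivity)]
  intro c
  have h1 : minors 1 v = minors H⁻¹ fun i => H.mulVec (v i) := by
    ext c
    simp [minors, Matrix.mulVec_mulVec, Matrix.nonsing_inv_mul H hH]
  have h2 := factorial_mul_minors H⁻¹ (fun i => H.mulVec (v i)) c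
  rw [← h1] at h2
  have h3 : (1 : ℝ) ≤ r.factorial := by exact_mod_cast Nat.one_le_iff_ne_zero.2 (Nat.factorial_ne_zero r)
  calc ‖minors 1 v c‖ ≤ ‖(r.factorial : ℝ) * minors 1 v c‖ := by
        rw [norm_mul, Real.norm_natCast]
        exact le_mul_of_one_le_left (norm_nonneg _) h3
    _ ≤ ∑ f : Fin r → Fin k, ‖minors H v‖ * ‖(Matrix.of fun i j => H⁻¹ (c j) (f i)).det‖ := by
        rw [h2]
        refine (norm_sum_le _ _).trans (Finset.sum_le_sum fun f _ => ?_)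
        rw [norm_mul]
        gcongr
        exact norm_le_pi_norm (minors H v) f
    _ = ‖minors H v‖ * ∑ f : Fin r → Fin k, ‖(Matrix.of fun i j => H⁻¹ (c j) (f i)).det‖ := by
        rw [Finset.mul_sum]
    _ ≤ ‖minors H v‖ * B := by
        gcongr
        exact Finset.single_le_sum (f := fun c : Fin r → Fin k => ∑ f : Fin r → Fin k,
          ‖(Matrix.of fun i j => H⁻¹ (c j) (f i)).det‖)
          (fun _ _ => Finset.sum_nonneg fun _ _ => norm_nonneg _) (Finset.mem_univ c)
    _ = _ := mul_comm _ _

/-- Only finitely many covolume functions are small at a given point. -/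
theorem finite_covol_lt {k : ℕ} (H : ℝ → Matrix (Fin k) (Fin k) ℝ) (y : ℝ)
    (hH : IsUnit (H y).det) (ρ : ℝ) (A : Set (Submodule ℚ (Fin k → ℚ))) :
    ((fun V x => covol (H x) V) '' {V ∈ A | covol (H y) V < ρ}).Finite := by
  choose M hM using fun r => exists_norm_minors_one_le hH r
  -- By Cauchy–Binet a covolume function depends only on the rank and the integer minors of the
  -- basis; a small covolume at `y` bounds those minors.
  let Φ : (r : ℕ) → ((Fin r → Fin k) → ℤ) → ℝ → ℝ := fun r m x =>
    ‖fun c : Fin r → Fin k => (r.factorial : ℝ)⁻¹ * ∑ f : Fin r → Fin k,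
      (m f : ℝ) * (Matrix.of fun i j => H x (c j) (f i)).det‖
  let 𝓜 : (r : ℕ) → Set ((Fin r → Fin k) → ℤ) := fun r =>
    Set.pi Set.univ fun _ => Set.Icc (-⌈|M r| * |ρ|⌉) ⌈|M r| * |ρ|⌉
  have hfin : (⋃ r ∈ Finset.range (k + 1), Φ r '' 𝓜 r).Finite :=
    Set.Finite.biUnion (Finset.finite_toSet _) fun r _ =>
      (Set.Finite.pi fun _ => Set.finite_Icc _ _).image _
  refine hfin.subset ?_
  rintro _ ⟨V, ⟨_, hV⟩, rfl⟩
  have hrank : Module.finrank ℚ V < k + 1 := by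
    have h := Submodule.finrank_le V
    rw [Module.finrank_fin_fun] at h
    omega
  simp only [Set.mem_iUnion, Finset.mem_range]
  refine ⟨Module.finrank ℚ V, hrank,
    fun c => (Matrix.of fun i j => subspaceBasis V i (c j)).det, ?_, ?_⟩
  · intro c _
    have h1 : ‖minors 1 (toReal (subspaceBasis V)) c‖ ≤ |M (Module.finrank ℚ V)| * |ρ| :=
      ((norm_le_pi_norm _ c).trans (hM _ _)).trans
        (mul_le_mul (le_abs_self _) (hV.le.trans (le_abs_self _)) (norm_nonneg _) (abs_nonneg _))
    have h2 : minors 1 (toReal (subspaceBasis V)) c =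
        ((Matrix.of fun i j => subspaceBasis V i (c j)).det : ℤ) := by
      rw [minors, Int.cast_det]
      simp [toReal, Matrix.map]
    rw [h2, Real.norm_eq_abs, abs_le] at h1
    rw [Set.mem_Icc]
    constructor
    · rw [neg_le, Int.le_ceil_iff]
      rw [Int.cast_neg]
      linarith
    · rw [Int.le_ceil_iff]
      linarith
  · ext x
    simp only [Φ, covol]
    congr 1
    ext c
    have h1 := factorial_mul_minors (H x) (toReal (subspaceBasis V)) c
    rw [inv_mul_eq_iff_eq_mul₀ (by positivity), h1]
    refine Finset.sum_congr rfl fun f _ => ?_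
    congr 1
    rw [Int.cast_det]
    simp [toReal, Matrix.map]

theorem wedgeAct_intWedge {k r : ℕ} (L : SL(k, ℝ)) (p : Fin r → Fin k → ℤ) :
    wedgeAct L (intWedge p) = ((exteriorPower.ιMulti ℝ r (M := E k)).compLinearMap
      (WithLp.linearEquiv 2 ℝ (Fin k → ℝ)).symm.toLinearMap) fun i => L.1.mulVec (toReal p i) := by
  rw [wedgeAct, intWedge, exteriorPower.map_apply_ιMulti]
  rfl

/-- The norm of a multivector is bounded in terms of the minors. -/
theorem exists_norm_wedgeAct_le (k r : ℕ) : ∃ K : ℝ, 0 ≤ K ∧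
    ∀ (L : SL(k, ℝ)) (p : Fin r → Fin k → ℤ),
      ‖wedgeAct L (intWedge p)‖ ≤ K * ‖minors L.1 (toReal p)‖ := by
  set A := (exteriorPower.ιMulti ℝ r (M := E k)).compLinearMap
      (WithLp.linearEquiv 2 ℝ (Fin k → ℝ)).symm.toLinearMap with hA
  refine ⟨∑ f : Fin r → Fin k, ‖A fun j => Pi.single (f j) 1‖,
    Finset.sum_nonneg fun _ _ => norm_nonneg _, fun L p => ?_⟩
  rw [wedgeAct_intWedge, ← hA]
  have h := factorial_smul_alternatingMap A fun i => L.1.mulVec (toReal p i)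
  have h3 : (1 : ℝ) ≤ r.factorial := by
    exact_mod_cast Nat.one_le_iff_ne_zero.2 (Nat.factorial_ne_zero r)
  calc ‖A fun i => L.1.mulVec (toReal p i)‖
      ≤ ‖(r.factorial : ℝ) • A fun i => L.1.mulVec (toReal p i)‖ := by
        rw [norm_smul, Real.norm_natCast]
        exact le_mul_of_one_le_left (norm_nonneg _) h3
    _ ≤ ∑ f : Fin r → Fin k, ‖A fun j => Pi.single (f j) 1‖ * ‖minors L.1 (toReal p)‖ := by
        rw [h]
        refine (norm_sum_le _ _).trans (Finset.sum_le_sum fun f _ => ?_)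
        rw [norm_smul, mul_comm]
        gcongr
        exact norm_le_pi_norm (minors L.1 (toReal p)) f
    _ = _ := by rw [Finset.sum_mul]

/-- A nonzero minor of `p` is the value of a linear functional on the exterior power. -/
theorem intWedge_ne_zero {k r : ℕ} {p : Fin r → Fin k → ℤ}
    (hp : LinearIndependent ℚ (toRat p)) : intWedge p ≠ 0 := by
  intro h
  obtain ⟨f, hf⟩ := exists_minor_ne_zero hp
  apply hf
  let A : (E k) [⋀^Fin r]→ₗ[ℝ] ℝ :=
    (minorMap 1 f).compLinearMap (WithLp.linearEquiv 2 ℝ (Fin k → ℝ)).toLinearMap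
  have h1 := exteriorPower.alternatingMapLinearEquiv_apply_ιMulti A fun j => intVec (p j)
  rw [show exteriorPower.ιMulti ℝ r (fun j => intVec (p j)) = 0 from h, map_zero] at h1
  have h2 : A (fun j => intVec (p j)) = minorMap 1 f (toReal p) := rfl
  rw [h2, minorMap_apply] at h1
  simp only [Matrix.one_mulVec] at h1
  have h3 : (((Matrix.of fun i j => p i (f j)).det : ℤ) : ℝ) = 0 := by
    rw [Int.cast_det, h1]
    rfl
  exact_mod_cast h3

end QND

/-! ### The covolume functions of the curve. -/

namespace QND

theorem analyticAt_uMatrix {n : ℕ} {f : ℝ → Fin n → ℝ} {x : ℝ}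
    (hf : ∀ j, AnalyticAt ℝ (fun t => f t j) x) (i j : Fin (n + 1)) :
    AnalyticAt ℝ (fun t => uMatrix (f t) i j) x := by
  refine Fin.cases ?_ (fun i => ?_) i
  · refine Fin.cases ?_ (fun j => ?_) j
    · simpa [uMatrix] using analyticAt_const
    · simpa [uMatrix] using hf j
  · simpa [uMatrix] using analyticAt_const

theorem analyticAt_u₁Matrix {m : ℕ} {f : ℝ → Fin m → ℝ} {x : ℝ}
    (hf : ∀ j, AnalyticAt ℝ (fun t => f t j) x) (i j : Fin (m + 2)) :
    AnalyticAt ℝ (fun t => u₁Matrix (f t) i j) x := by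
  refine Fin.cases ?_ (fun i => ?_) i
  · simpa [u₁Matrix] using analyticAt_const
  · refine Fin.cases ?_ (fun j => ?_) j
    · simpa [u₁Matrix] using analyticAt_const
    · simpa [u₁Matrix] using analyticAt_uMatrix hf i j

theorem analyticAt_det {n : Type*} [Fintype n] [DecidableEq n] {A : ℝ → Matrix n n ℝ} {x : ℝ}
    (hA : ∀ i j, AnalyticAt ℝ (fun t => A t i j) x) : AnalyticAt ℝ (fun t => (A t).det) x := by
  simp only [Matrix.det_apply']
  exact Finset.analyticAt_fun_sum _ fun σ _ =>
    analyticAt_const.mul (Finset.analyticAt_fun_prod _ fun i _ => hA _ _)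

/-- The index set of the minors of a square matrix. -/
abbrev MinorIndex (k : ℕ) : Type := Σ r : Fin (k + 1), (Fin r → Fin k) × (Fin r → Fin k)

/-- The minors of `z(x) u(φ(x))`. -/
noncomputable def zuMinor {m : ℕ} (φ : ℝ → Fin (m + 1) → ℝ) (e : MinorIndex (m + 2)) (x : ℝ) : ℝ :=
  (Matrix.of fun i j => ((z φ x).1 * (u (φ x)).1) (e.2.1 j) (e.2.2 i)).det

theorem analyticOnNhd_zuMinor {m : ℕ} {φ : ℝ → Fin (m + 1) → ℝ} {U : Set ℝ}
    (hφ : AnalyticOnNhd ℝ φ U) (e : MinorIndex (m + 2)) : AnalyticOnNhd ℝ (zuMinor φ e) U := by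
  have hcoord : ∀ j, AnalyticOnNhd ℝ (fun t => φ t j) U := fun j x hx =>
    (analyticAt_pi_iff.1 (hφ x hx)) j
  intro x hx
  refine analyticAt_det fun i j => ?_
  simp only [Matrix.of_apply, Matrix.mul_apply]
  refine Finset.analyticAt_fun_sum _ fun l _ => AnalyticAt.mul ?_ ?_
  · exact analyticAt_u₁Matrix (fun j => (hcoord j.succ).deriv x hx) _ _
  · exact analyticAt_uMatrix (fun j => hcoord j x hx) _ _

theorem H_val {m : ℕ} (φ : ℝ → Fin (m + 1) → ℝ) (τ : Fin (m + 2) → ℝ) (hτ : ∑ i, τ i = 0)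
    (x : ℝ) : (H φ τ hτ x).1 =
      Matrix.diagonal (fun i => Real.exp (τ i)) * ((z φ x).1 * (u (φ x)).1) := by
  rw [← Matrix.mul_assoc]
  rfl

/-- The minors of `H(x) v` lie in a fixed finite-dimensional space of functions of `x`. -/
theorem exists_minors_H_eq {m r : ℕ} (hr : r < m + 3) (φ : ℝ → Fin (m + 1) → ℝ)
    (τ : Fin (m + 2) → ℝ) (hτ : ∑ i, τ i = 0) (v : Fin r → Fin (m + 2) → ℝ)
    (c : Fin r → Fin (m + 2)) :
    ∃ a : MinorIndex (m + 2) → ℝ, ∀ x,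
      minors (H φ τ hτ x).1 v c = ∑ e, a e * zuMinor φ e x := by
  have hmem : (fun x => minors (H φ τ hτ x).1 v c) ∈ Submodule.span ℝ (Set.range (zuMinor φ)) := by
    have heq : (fun x => minors (H φ τ hτ x).1 v c) = ∑ f : Fin r → Fin (m + 2),
        ((∏ j, Real.exp (τ (c j))) * (r.factorial : ℝ)⁻¹ *
          (Matrix.of fun i j => v i (f j)).det) • zuMinor φ ⟨⟨r, hr⟩, c, f⟩ := by
      ext x
      -- The diagonal matrix only rescales each minor by a constant; this is why all later constants
      -- are uniform in `τ`.
      have h1 : minors (H φ τ hτ x).1 v c =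
          (∏ j, Real.exp (τ (c j))) * minors ((z φ x).1 * (u (φ x)).1) v c := by
        simp only [minors, H_val]
        rw [← Matrix.det_mul_row]
        congr 1
        ext i j
        simp only [Matrix.of_apply, ← Matrix.mulVec_mulVec, Matrix.mulVec_diagonal]
      have h2 := factorial_mul_minors ((z φ x).1 * (u (φ x)).1) v c
      rw [h1, ← inv_mul_cancel_left₀ (show (r.factorial : ℝ) ≠ 0 by positivity)
        (minors ((z φ x).1 * (u (φ x)).1) v c), h2]
      simp only [Finset.sum_apply, Pi.smul_apply, smul_eq_mul, Finset.mul_sum, zuMinor]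
      exact Finset.sum_congr rfl fun f _ => by ring
    rw [heq]
    exact Submodule.sum_mem _ fun f _ => Submodule.smul_mem _ _
      (Submodule.subset_span ⟨_, rfl⟩)
  obtain ⟨a, ha⟩ := (Submodule.mem_span_range_iff_exists_fun ℝ).1 hmem
  refine ⟨a, fun x => ?_⟩
  rw [← congrFun ha x]
  simp [Finset.sum_apply]

theorem finrank_lt {k : ℕ} (V : Submodule ℚ (Fin k → ℚ)) : Module.finrank ℚ V < k + 1 := by
  have h := Submodule.finrank_le V
  rw [Module.finrank_fin_fun] at h
  omega

theorem continuousOn_covol_H {m : ℕ} {φ : ℝ → Fin (m + 1) → ℝ} {U : Set ℝ}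
    (hφ : AnalyticOnNhd ℝ φ U) (τ : Fin (m + 2) → ℝ) (hτ : ∑ i, τ i = 0)
    (V : Submodule ℚ (Fin (m + 2) → ℚ)) :
    ContinuousOn (fun x => covol (H φ τ hτ x).1 V) U := by
  refine ContinuousOn.norm (continuousOn_pi.2 fun c => ?_)
  obtain ⟨a, ha⟩ := exists_minors_H_eq (finrank_lt V) φ τ hτ (toReal (subspaceBasis V)) c
  simp only [ha]
  exact continuousOn_finsetSum _ fun e _ =>
    continuousOn_const.mul (analyticOnNhd_zuMinor hφ e).continuousOn

/-- A covolume is a maximum of absolute values of minors. The single minor that reaches `σ` is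
already a good function, and it is at most `ε` wherever the covolume is. -/
theorem IsAhlforsRegular.exists_covol_good {m : ℕ} {U : Set ℝ} (hUo : IsOpen U)
    (hU : IsPreconnected U) {μ : Measure ℝ} {C α ρ₀ : ℝ} (hμ : IsAhlforsRegular C α ρ₀ μ)
    {φ : ℝ → Fin (m + 1) → ℝ} (hφ : AnalyticOnNhd ℝ φ U) {x₀ : ℝ} (hx₀ : x₀ ∈ U) :
    ∃ η c γ : ℝ, 0 < η ∧ 0 ≤ c ∧ 0 < γ ∧ Set.Icc (x₀ - η) (x₀ + η) ⊆ U ∧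
      ∀ (τ : Fin (m + 2) → ℝ) (hτ : ∑ i, τ i = 0) (V : Submodule ℚ (Fin (m + 2) → ℚ))
        (ε σ : ℝ), 0 < ε → 0 < σ → ∀ s t, s < t → t - s ≤ ρ₀ →
        Set.Icc s t ⊆ Set.Icc (x₀ - η) (x₀ + η) →
        (∃ x ∈ Set.Icc s t, σ ≤ covol (H φ τ hτ x).1 V) →
        μ {x ∈ Set.Icc s t | covol (H φ τ hτ x).1 V < ε} ≤
          ENNReal.ofReal (c * (ε / σ) ^ γ * (t - s) ^ α) := by
  obtain ⟨η, L, c, hη, hL, hc, hsub, hgood⟩ :=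
    exists_good hUo hU (fun e => analyticOnNhd_zuMinor hφ e) hx₀
  have hC := hμ.one_lt_C
  have hα := hμ.alpha_pos
  have hL0 : (0 : ℝ) < L := by exact_mod_cast hL
  refine ⟨η, L * C * (2 * c) ^ (α / L), α / L, hη, by positivity, by positivity, hsub, ?_⟩
  intro τ hτ V ε σ hε hσ s t hst hρ hI hx
  obtain ⟨x, hx, hσx⟩ := hx
  obtain ⟨d, hd⟩ : ∃ d, σ ≤ ‖minors (H φ τ hτ x).1 (toReal (subspaceBasis V)) d‖ := by
    by_contra! hcon
    exact absurd ((pi_norm_lt_iff hσ).2 hcon) (not_lt.2 hσx)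
  obtain ⟨a, ha⟩ := exists_minors_H_eq (finrank_lt V) φ τ hτ (toReal (subspaceBasis V)) d
  rw [ha] at hd
  refine le_trans (measure_mono ?_) (hμ.measure_abs_le_le (f := fun x => ∑ e, a e * zuMinor φ e x)
    hL hc (fun δ S hS hcard hδ hδst hsep hεS => hgood a s t δ ε S hI hS hcard hδ hδst hsep hεS)
    hst hρ hε hσ ⟨x, hx, hd⟩)
  rintro y ⟨hy, hyε⟩
  refine ⟨hy, ?_⟩
  have h1 := norm_le_pi_norm (minors (H φ τ hτ y).1 (toReal (subspaceBasis V))) d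
  rw [ha] at h1
  exact h1.trans hyε.le

/-- A point of `W` is not marked. -/
theorem not_marked_of_mem_W {m : ℕ} {φ : ℝ → Fin (m + 1) → ℝ} {τ : Fin (m + 2) → ℝ}
    {hτ : ∑ i, τ i = 0} {J : Set ℝ} {δ ρ x : ℝ} (hδρ : ((m + 2 : ℕ) : ℝ) * δ ≤ ρ) (hρ : ρ ≤ 1)
    (hx : x ∈ W φ τ hτ J δ) :
    ¬ Marked (fun V y => covol (H φ τ hτ y).1 V) (properSubspaces (m + 2))
      (((m + 2 : ℕ) : ℝ) * δ) ρ x := by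
  intro hm
  apply hx.2
  refine ⟨⟨_, rfl⟩, ?_⟩
  rintro _ ⟨p, rfl⟩ hv
  by_contra! hlt
  have hp : p ≠ 0 := by
    rintro rfl
    apply hv
    have : intVec (0 : Fin (m + 2) → ℤ) = 0 := by ext i; simp [intVec]
    simp only [this, map_zero]
  have h1 := le_norm_mulVec_of_marked (H := fun y => (H φ τ hτ y).1) (H φ τ hτ x).2 hδρ hρ hm hp
  have h2 : ‖(H φ τ hτ x).1.mulVec fun j => (p j : ℝ)‖ ≤
      ‖Matrix.toEuclideanLin (H φ τ hτ x).1 (intVec p)‖ := by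
    rw [pi_norm_le_iff_of_nonneg (norm_nonneg _)]
    intro i
    exact PiLp.norm_apply_le (Matrix.toEuclideanLin (H φ τ hτ x).1 (intVec p)) i
  have h3 : (0 : ℝ) < ((m + 2 : ℕ) : ℝ) := by positivity
  nlinarith

/-- Such an `x` is within `|J|` of the midpoint, and a third of that is strictly less than `|J| /
2`; so it is immaterial which endpoints `J` contains. -/
theorem mem_dilate_three {J : Set ℝ} (hJ : J.OrdConnected) (hbb : BddBelow J) (hba : BddAbove J)
    (hlt : sInf J < sSup J) {x y : ℝ} (hy : y ∈ J) (hxy : |x - y| ≤ (sSup J - sInf J) / 2) :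
    x ∈ dilate 3 J := by
  have hne : J.Nonempty := ⟨y, hy⟩
  have hIoo : Set.Ioo (sInf J) (sSup J) ⊆ J := by
    intro w hw
    obtain ⟨p, hp, hpw⟩ := (csInf_lt_iff hbb hne).1 hw.1
    obtain ⟨q, hq, hwq⟩ := (lt_csSup_iff hba hne).1 hw.2
    exact hJ.out hp hq ⟨hpw.le, hwq.le⟩
  have h1 := csInf_le hbb hy
  have h2 := le_csSup hba hy
  rw [abs_le] at hxy
  refine ⟨center J + (x - center J) / 3, hIoo ⟨?_, ?_⟩, by simp only; ring⟩ <;>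
    simp only [center] <;> linarith

end QND

/-! ### The local estimate. -/

theorem mainTheorem5 (m : ℕ) (U : Set ℝ) (hUopen : IsOpen U) (hUint : U.OrdConnected)
    (μ : Measure ℝ) (C α ρ₀ : ℝ) (hμ : QND.IsAhlforsRegular C α ρ₀ μ)
    (φ : ℝ → Fin (m + 1) → ℝ) (hφ : AnalyticOnNhd ℝ φ U) (hφnd : QND.Nondegenerate U φ)
    (x₀ : ℝ) (hx₀ : x₀ ∈ μ.support ∩ U) :
    ∃ η : ℝ, 0 < η ∧
      ∀ (ℓ : ℝ) (I₀ : Set ℝ), I₀ = QND.centredInterval x₀ ℓ → 0 < ℓ → ℓ ≤ η →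
        QND.dilate (3 ^ (m + 2)) I₀ ⊆ U →
        (∀ x ∈ QND.dilate (3 ^ (m + 2)) I₀, φ x 0 = x) →
        3 * ℓ ≤ ρ₀ →
        ∃ M₁ γ : ℝ, 0 < M₁ ∧ 0 < γ ∧
          ∀ (δ : ℝ), 0 < δ →
          ∀ (τ : Fin (m + 2) → ℝ) (hτ : ∑ i, τ i = 0),
          ∀ (ρ : ℝ), 0 ≤ ρ → ρ ≤ 1 →
          ∀ (J : Set ℝ), J.OrdConnected → J ⊆ I₀ →
            μ (QND.W φ τ hτ J δ) ≤
                ENNReal.ofReal M₁ * (ENNReal.ofReal δ / ENNReal.ofReal ρ) ^ γ *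
                  μ (QND.dilate 3 J) ∨
            ∃ (i : ℕ) (p : Fin i → Fin (m + 2) → ℤ),
              1 ≤ i ∧ i ≤ m + 1 ∧ QND.intWedge p ≠ 0 ∧
              (⨆ x ∈ J, ENNReal.ofReal ‖QND.wedgeAct (QND.H φ τ hτ x) (QND.intWedge p)‖) <
                ENNReal.ofReal ρ := by
  obtain ⟨η, c, γ, hη, hc, hγ, hηU, hgood⟩ :=
    hμ.exists_covol_good hUopen hUint.isPreconnected hφ hx₀.2
  have hC := hμ.one_lt_C
  have hα := hμ.alpha_pos
  refine ⟨η, hη, ?_⟩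
  rintro ℓ I₀ rfl hℓ hℓη - - hℓρ
  obtain ⟨D, hD, hmain⟩ := hμ.exists_measure_not_marked_le
    (P := Submodule ℚ (Fin (m + 2) → ℚ)) (I := Set.Icc (x₀ - η) (x₀ + η)) (γ := γ) hc (m + 2 + 1)
  choose Kr hKr0 hKr using QND.exists_norm_wedgeAct_le (m + 2)
  -- One constant comparing multivector norms with minors in every degree; the threshold for
  -- covolumes will be `ρ / K`.
  set K : ℝ := 1 + ∑ r ∈ Finset.range (m + 3), Kr r with hK
  have hK1 : 1 ≤ K := by
    have : 0 ≤ ∑ r ∈ Finset.range (m + 3), Kr r := Finset.sum_nonneg fun r _ => hKr0 r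
    linarith
  have hKle : ∀ r < m + 3, Kr r ≤ K := fun r hr => by
    have := Finset.single_le_sum (f := Kr) (fun r _ => hKr0 r) (Finset.mem_range.2 hr)
    linarith
  set k : ℝ := ((m + 2 : ℕ) : ℝ) with hk
  have hk0 : 0 < k := by positivity
  have hkK : 0 < k * K := by positivity
  -- The first summand serves the covering estimate, with `C * 2 ^ α` from the lower bound for
  -- `μ(3J)`. The second makes alternative 1 trivial when `k * δ > ρ / K`.
  refine ⟨D * (k * K) ^ γ * C * 2 ^ α + (k * K) ^ γ, γ, by positivity, hγ, ?_⟩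
  intro δ hδ τ hτ ρ hρ0 hρ1 J hJ hJI
  set M₁ := D * (k * K) ^ γ * C * 2 ^ α + (k * K) ^ γ with hM₁
  have hM₁0 : 0 < M₁ := by positivity
  by_cases hW0 : μ (QND.W φ τ hτ J δ) = 0
  · left
    rw [hW0]
    exact zero_le
  have hWJ : QND.W φ τ hτ J δ ⊆ J := fun x hx => hx.1
  obtain ⟨y, hyW, hys⟩ : (QND.W φ τ hτ J δ ∩ μ.support).Nonempty := by
    rw [Set.nonempty_iff_ne_empty]
    intro h
    rw [← QND.measure_inter_support, h, measure_empty] at hW0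
    exact hW0 rfl
  have hyJ := hWJ hyW
  have hne : J.Nonempty := ⟨y, hyJ⟩
  have hbb : BddBelow J := bddBelow_Icc.mono hJI
  have hba : BddAbove J := bddAbove_Icc.mono hJI
  set a := sInf J with ha
  set b := sSup J with hb
  have hJab : J ⊆ Set.Icc a b := fun x hx => ⟨csInf_le hbb hx, le_csSup hba hx⟩
  have hab : a < b := by
    by_contra hcon
    apply hW0
    refine measure_mono_null (fun x hx => ?_) (hμ.measure_singleton a)
    have := hJab (hWJ hx)
    exact le_antisymm (this.2.trans (not_lt.1 hcon)) this.1
  have haI : x₀ - ℓ / 2 ≤ a := le_csInf hne fun x hx => (hJI hx).1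
  have hbI : b ≤ x₀ + ℓ / 2 := csSup_le hne fun x hx => (hJI hx).2
  have habI : Set.Icc a b ⊆ Set.Icc (x₀ - η) (x₀ + η) :=
    Set.Icc_subset_Icc (by linarith) (by linarith)
  have hJ3 : J ⊆ QND.dilate 3 J := fun x hx =>
    QND.mem_dilate_three hJ hbb hba hab hx (by rw [sub_self, abs_zero]; linarith)
  -- The lower bound needs a ball centred in the support; its centre may be near an end of `J`,
  -- whence the tripled interval.
  have hball : ENNReal.ofReal (C⁻¹ * ((b - a) / 2) ^ α) ≤ μ (QND.dilate 3 J) := by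
    refine (hμ.lower y hys _ (by linarith) (by linarith)).trans (measure_mono fun x hx => ?_)
    rw [Metric.mem_closedBall, Real.dist_eq] at hx
    exact QND.mem_dilate_three hJ hbb hba hab hyJ hx
  have hW3 : μ (QND.W φ τ hτ J δ) ≤ μ (QND.dilate 3 J) := measure_mono (hWJ.trans hJ3)
  rcases hρ0.eq_or_lt with rfl | hρ
  · left
    have h1 : μ (QND.dilate 3 J) ≠ 0 := fun h => hW0 (le_antisymm (h ▸ hW3) zero_le)
    rw [ENNReal.ofReal_zero, ENNReal.div_zero (by simpa using hδ), ENNReal.top_rpow_of_pos hγ,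
      ENNReal.mul_top (by simpa using hM₁0), ENNReal.top_mul h1]
    exact le_top
  have hq : ENNReal.ofReal M₁ * (ENNReal.ofReal δ / ENNReal.ofReal ρ) ^ γ =
      ENNReal.ofReal (M₁ * (δ / ρ) ^ γ) := by
    rw [← ENNReal.ofReal_div_of_pos hρ, ENNReal.ofReal_rpow_of_pos (by positivity),
      ← ENNReal.ofReal_mul hM₁0.le]
  have hsplit : k * δ / (ρ / K) = k * K * (δ / ρ) := by field_simp
  rw [hq]
  rcases lt_or_ge (ρ / K) (k * δ) with hbig | hsmall
  · left
    have h1 : 1 ≤ M₁ * (δ / ρ) ^ γ := by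
      have h2 : 1 ≤ k * K * (δ / ρ) := by
        rw [← hsplit, one_le_div (by positivity)]
        exact hbig.le
      have h3 : 1 ≤ (k * K) ^ γ * (δ / ρ) ^ γ := by
        rw [← Real.mul_rpow hkK.le (by positivity)]
        exact Real.one_le_rpow h2 hγ.le
      refine h3.trans (mul_le_mul_of_nonneg_right ?_ (by positivity))
      have : 0 ≤ D * (k * K) ^ γ * C * 2 ^ α := by positivity
      linarith
    calc μ (QND.W φ τ hτ J δ) ≤ 1 * μ (QND.dilate 3 J) := by rwa [one_mul]
      _ ≤ _ := by
        gcongr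
        rwa [ENNReal.one_le_ofReal]
  by_cases hright : ∃ (i : ℕ) (p : Fin i → Fin (m + 2) → ℤ),
      1 ≤ i ∧ i ≤ m + 1 ∧ QND.intWedge p ≠ 0 ∧
      (⨆ x ∈ J, ENNReal.ofReal ‖QND.wedgeAct (QND.H φ τ hτ x) (QND.intWedge p)‖) <
        ENNReal.ofReal ρ
  · exact Or.inr hright
  left
  have hsup : ∀ V ∈ QND.properSubspaces (m + 2),
      ∃ x ∈ Set.Icc a b, ρ / K ≤ QND.covol (QND.H φ τ hτ x).1 V := by
    intro V hV
    by_contra! hcon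
    apply hright
    -- The maximum over the closed interval is attained, so the inequality stays strict after taking
    -- the supremum over `J`.
    obtain ⟨xm, hxm, hmax⟩ := isCompact_Icc.exists_isMaxOn (Set.nonempty_Icc.2 hab.le)
      ((QND.continuousOn_covol_H hφ τ hτ V).mono (habI.trans hηU))
    refine ⟨Module.finrank ℚ V, QND.subspaceBasis V, ?_, ?_,
      QND.intWedge_ne_zero (QND.linearIndependent_subspaceBasis V), ?_⟩
    · exact Nat.one_le_iff_ne_zero.2 fun h => hV.1 (Submodule.finrank_eq_zero.1 h)
    · have := Submodule.finrank_lt hV.2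
      rw [Module.finrank_fin_fun] at this
      omega
    · refine lt_of_le_of_lt (b := ENNReal.ofReal (K * QND.covol (QND.H φ τ hτ xm).1 V)) ?_ ?_
      · refine iSup₂_le fun x hx => ENNReal.ofReal_le_ofReal ((hKr _ _ _).trans ?_)
        exact mul_le_mul (hKle _ (QND.finrank_lt V)) (hmax (hJab hx)) (norm_nonneg _) (by linarith)
      · rw [ENNReal.ofReal_lt_ofReal_iff hρ]
        have := hcon xm hxm
        rw [lt_div_iff₀ (by linarith)] at this
        linarith
  have hρK : ρ / K ≤ 1 := (div_le_one (by linarith)).2 (hρ1.trans hK1)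
  have hbound := hmain (fun V x => QND.covol (QND.H φ τ hτ x).1 V) (QND.properSubspaces (m + 2))
    (k * δ) (ρ / K) (by positivity) (by positivity)
    (fun F _ hF => QND.card_le_of_isChain F hF)
    (fun V _ => (QND.continuousOn_covol_H hφ τ hτ V).mono hηU)
    (fun y _ => QND.finite_covol_lt _ y (by rw [(QND.H φ τ hτ y).2]; exact isUnit_one) _ _)
    (fun V _ s t hst hρ' hI hx => hgood τ hτ V _ _ (by positivity) (by positivity) s t hst hρ' hI hx)
    a b hab (by linarith) habI hsup
  calc μ (QND.W φ τ hτ J δ)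
      ≤ ENNReal.ofReal (D * (k * δ / (ρ / K)) ^ γ * (b - a) ^ α) := by
        refine (measure_mono fun x hx => ?_).trans hbound
        exact ⟨hJab (hWJ hx), QND.not_marked_of_mem_W hsmall hρK hx⟩
    _ ≤ ENNReal.ofReal (M₁ * (δ / ρ) ^ γ * (C⁻¹ * ((b - a) / 2) ^ α)) := by
        refine ENNReal.ofReal_le_ofReal ?_
        have hba0 : 0 ≤ b - a := by linarith
        have h1 : D * (k * δ / (ρ / K)) ^ γ * (b - a) ^ α =
            D * (k * K) ^ γ * C * 2 ^ α * (δ / ρ) ^ γ * (C⁻¹ * ((b - a) / 2) ^ α) := by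
          rw [hsplit, Real.mul_rpow hkK.le (by positivity),
            Real.div_rpow hba0 (by norm_num)]
          field_simp
        rw [h1]
        have h2 : 0 ≤ (k * K) ^ γ := by positivity
        gcongr
        linarith
    _ = ENNReal.ofReal (M₁ * (δ / ρ) ^ γ) * ENNReal.ofReal (C⁻¹ * ((b - a) / 2) ^ α) :=
        ENNReal.ofReal_mul (by positivity)
    _ ≤ _ := by gcongr
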